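/- Let $\Sigma$ be a finite alphabet, $\Sigma^*$ the set of finite strings over $\Sigma$, and $\mathcal B$ the set of all functions $\varphi\colon\Sigma^*\to\Sigma^*$ (oracles). An operator is a map $F\colon\mathcal B\to\mathcal B$; composition is composition of maps, $(F\circ G)(\varphi)=F(G(\varphi))$. An oracle machine is a deterministic multi-tape Turing machine with distinct query and answer tapes and a designated oracle state. Whenever a step enters the oracle state while $\mathbf b\in\Sigma^*$ is written on the query tape, the contents of the answer tape are replaced by $\varphi(\mathbf b)$ and the heads of both tapes return to their initial positions; this costs no more than the step itself. The machine computes $F$ if for every oracle $\varphi$ and input $\mathbf a$ it halts with output $F(\varphi)(\mathbf a)$. It has a polynomial step-count if there is a polynomial $p$ such that, for every $\varphi$ and $\mathbf a$, it halts after at most $p(m_{\varphi,\mathbf a})$ steps, where $m_{\varphi,\mathbf a}$ is the maximum of the lengths of the input $\mathbf a$ and of all oracle answers received in the run. A lookahead revision is an event in a run where a query is posed whose length exceeds the lengths of all previous queries of that run (so the first query is one). The machine has finite lookahead revision if there is a number $r$ such that on every oracle and input at most $r$ lookahead revisions happen. Let $\mathrm{MPT}$ be the class of operators computed by an oracle machine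 that has both a polynomial step-count and finite lookahead revision, and $\mathrm{MPT}_1\subseteq\mathrm{MPT}$ the class of operators computed by an oracle machine that has a polynomial step-count and makes at most one lookahead revision on every oracle and input. **Lemma.** Let $F,G\in\mathrm{MPT}$ be such that the machine computing $G$ makes only one lookahead revision, that is, $F\in\mathrm{MPT}$ and $G\in\mathrm{MPT}_1$. Then $F\circ G\in\mathrm{MPT}$. -/

import Mathlib

namespace TypeTwo

universe u

/-- The Baire space over the alphabet `A`: all functions from finite strings to finite strings. -/
abbrev Baire (A : Type u) : Type u := List A → List A

/-- (Total) operators on the Baire space. -/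
abbrev Operator (A : Type u) : Type u := Baire A → Baire A

/-- Head movements. -/
inductive Move : Type
  | left
  | stay
  | right

/-- Tape names: an input tape, an output tape, the query tape, the answer tape, and further
work tapes named by `W`. -/
inductive TapeName (W : Type) : Type
  | input
  | output
  | query
  | answer
  | work (w : W)

/-- A tape cell is blank (`none`) or holds a letter of `A` or an auxiliary symbol of `B`. -/
abbrev Cell (A : Type u) (B : Type) : Type u := Option (A ⊕ B)

/-- The letter of `A` in a cell, if there is one. -/
def Cell.letter? {A : Type u} {B : Type} : Cell A B → Option A
  | some (Sum.inl x) => some x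
  | _ => none

/-- A one-way infinite tape; the initial position of the head is cell `0`. -/
structure Tape (A : Type u) (B : Type) : Type u where
  cells : ℕ → Cell A B
  head : ℕ

namespace Tape

variable {A : Type u} {B : Type}

/-- The tape holding exactly the string `w`, followed by blanks, with the head in initial
position. -/
def ofWord (w : List A) : Tape A B where
  cells i := (w[i]?).map Sum.inl
  head := 0

/-- The symbol under the head. -/
def read (t : Tape A B) : Cell A B := t.cells t.head

/-- Overwrite the cell under the head, then move the head (a left move on cell `0` has no
effect). -/
def writeMove (t : Tape A B) (c : Cell A B) (m : Move) : Tape A B where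
  cells := Function.update t.cells t.head c
  head := match m with
    | Move.left => t.head - 1
    | Move.stay => t.head
    | Move.right => t.head + 1

/-- Return the head to its initial position. -/
def rewind (t : Tape A B) : Tape A B := { t with head := 0 }

/-- The string written on the tape: the letters from cell `0` up to, and excluding, the first
cell that does not hold a letter. (On every tape of a reachable configuration, all but finitely
many cells are blank, so that such a cell exists.) -/
noncomputable def word (t : Tape A B) : List A :=
  (List.range (sInf {n | (t.cells n).letter? = none})).filterMap fun i => (t.cells i).letter?

end Tape

/-- A deterministic multi-tape oracle Turing machine over the alphabet `A`. On a state and the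
symbols under the heads, `trans` says to halt (`none`), or gives the next state and, for each tape,
the symbol to write and the head movement. -/
structure OracleMachine (A : Type u) : Type (max u 1) where
  /-- states -/
  State : Type
  /-- auxiliary tape symbols -/
  Aux : Type
  /-- names of the work tapes -/
  Work : Type
  [finState : Finite State]
  [finAux : Finite Aux]
  [finWork : Finite Work]
  start : State
  oracleState : State
  trans : State → (TapeName Work → Cell A Aux) →
    Option (State × (TapeName Work → Cell A Aux × Move))

namespace OracleMachine

variable {A : Type u} (M : OracleMachine A)

/-- Configurations. -/
structure Config : Type u where
  state : M.State
  tape : TapeName M.Work → Tape A M.Aux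

/-- The initial configuration: the input is on the input tape, all other tapes are blank. -/
def init (a : List A) : M.Config where
  state := M.start
  tape
    | TapeName.input => Tape.ofWord a
    | _ => Tape.ofWord []

/-- One application of the transition function, without the effect of the oracle; `none` if the
machine halts. -/
def advance (c : M.Config) : Option M.Config :=
  (M.trans c.state fun i => (c.tape i).read).map fun s =>
    { state := s.1, tape := fun i => (c.tape i).writeMove (s.2 i).1 (s.2 i).2 }

/-- The effect of the oracle `φ`: the answer to the string on the query tape replaces the contents
of the answer tape, and the heads of both tapes return to their initial positions. -/
noncomputable def answer (φ : Baire A) (c : M.Config) : M.Config where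
  state := c.state
  tape
    | TapeName.query => (c.tape TapeName.query).rewind
    | TapeName.answer => Tape.ofWord (φ (c.tape TapeName.query).word)
    | i => c.tape i

open Classical in
/-- The query posed in the step that leaves the configuration `c`, if there is one: a query is
posed if this step enters the oracle state. -/
noncomputable def queryOf (c : M.Config) : Option (List A) :=
  (M.advance c).bind fun c' =>
    if c'.state = M.oracleState then some (c'.tape TapeName.query).word else none

open Classical in
/-- One step with oracle `φ`; `none` if the machine halts. Entering the oracle state counts as one
step, in which the answer is received at no further cost. -/
noncomputable def step (φ : Baire A) (c : M.Config) : Option M.Config :=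
  (M.advance c).map fun c' => if c'.state = M.oracleState then M.answer φ c' else c'

/-- The configuration after `t` steps with oracle `φ` on input `a` (constant from the moment the
machine halts). -/
noncomputable def run (φ : Baire A) (a : List A) : ℕ → M.Config
  | 0 => M.init a
  | t + 1 => (M.step φ (run φ a t)).getD (run φ a t)

/-- The query posed in the step from time `t` to time `t + 1`, if there is one. -/
noncomputable def queryAt (φ : Baire A) (a : List A) (t : ℕ) : Option (List A) :=
  M.queryOf (M.run φ a t)

/-- The machine halts with oracle `φ` on input `a` after exactly `T` steps. -/
def HaltsIn (φ : Baire A) (a : List A) (T : ℕ) : Prop :=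
  M.step φ (M.run φ a T) = none ∧ ∀ t < T, M.step φ (M.run φ a t) ≠ none

/-- The machine computes the operator `F`: for every oracle and input it halts with the value
of `F` on the output tape. -/
def Computes (F : Operator A) : Prop :=
  ∀ (φ : Baire A) (a : List A), ∃ T, M.HaltsIn φ a T ∧
    ((M.run φ a T).tape TapeName.output).word = F φ a

/-- The maximum of the lengths of the input and of all oracle answers received in the first `T`
steps with oracle `φ` on input `a`. -/
noncomputable def maxLength (φ : Baire A) (a : List A) (T : ℕ) : ℕ :=
  max a.length ((Finset.range T).sup fun t =>
    match M.queryAt φ a t with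
    | some b => (φ b).length
    | none => 0)

/-- `s` is a step-count of the machine: for every oracle and input the machine halts, and its number
of steps is at most `s m`, where `m` is the maximum of the lengths of the input and of all oracle
answers received in the run. -/
def HasStepCount (s : ℕ → ℕ) : Prop :=
  ∀ (φ : Baire A) (a : List A), ∃ T, M.HaltsIn φ a T ∧ T ≤ s (M.maxLength φ a T)

/-- The machine has a polynomial step-count. -/
def HasPolynomialStepCount : Prop :=
  ∃ p : Polynomial ℕ, M.HasStepCount fun n => p.eval n

/-- The times of the lookahead revisions in the run with oracle `φ` on input `a`: a query is posed
whose size exceeds the size of all previous queries. In particular the first query is one. -/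
def lookaheadRevisions (φ : Baire A) (a : List A) : Set ℕ :=
  {t | ∃ b, M.queryAt φ a t = some b ∧
    ∀ s < t, ∀ b', M.queryAt φ a s = some b' → b'.length < b.length}

/-- For every oracle and input, at most `r` lookahead revisions happen. -/
def LookaheadRevisionLE (r : ℕ) : Prop :=
  ∀ (φ : Baire A) (a : List A), (M.lookaheadRevisions φ a).encard ≤ r

/-- Finite lookahead revision: the number of lookahead revisions is bounded by a constant that
depends neither on the oracle nor on the input. -/
def FiniteLookaheadRevision : Prop :=
  ∃ r : ℕ, M.LookaheadRevisionLE r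

end OracleMachine

/-- Moderate polynomial time: the operators that are computed by an oracle machine that has both
a polynomial step-count and finite lookahead revision. -/
def MPT (A : Type u) : Set (Operator A) :=
  {F | ∃ M : OracleMachine A,
    M.Computes F ∧ M.HasPolynomialStepCount ∧ M.FiniteLookaheadRevision}

/-- The operators that are computed by an oracle machine that has a polynomial step-count and
never makes more than one lookahead revision. -/
def MPTOne (A : Type u) : Set (Operator A) :=
  {F | ∃ M : OracleMachine A,
    M.Computes F ∧ M.HasPolynomialStepCount ∧ M.LookaheadRevisionLE 1}

end TypeTwo

/-!
The composite machine runs the machine `M` of `F` and answers each of its queries by a run of the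
machine `N` of `G`. Two points need an argument.

*Lookahead revisions.* `N` makes at most one lookahead revision, so no query of `N` is longer than
the first one, before which no answer has been received. Therefore every query of `N` on an input of
length `n` has length at most `q n + 1`, where `q` is the step-count of `N`
(`OracleMachine.length_query_le_of_lookaheadRevisionLE_one`). But the length of the first query need
not be monotone in `n`, nor a function of `n`, so that naive composition can make many lookahead
revisions. The composite machine therefore poses, before it runs `N` on a query of `M` of length
`n`, an *inflated query* of length `(n + 2) ^ k - 1 ≥ q n + 1`, the answer to which it ignores; here
`k ≠ 0` depends on `q` only. Afterwards no query of this run of `N` is a lookahead revision, and as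
the length of the inflated query is strictly increasing in `n`, the inflated query is a lookahead
revision exactly if the query of `M` is one (`recordStep_inflate`, `exec_outer`).

*Time.* A machine cannot notice if the values of the oracle that it has not asked for are replaced
by the empty string, so a step-count bounds each initial segment of a run in terms of the answers
received in it (`OracleMachine.HasStepCount.le_of_not_halted`). Let `p` be the step-count of `M`,
let `r` bound the number of its lookahead revisions, and let `m` be the maximal length of the input
and of the answers of the oracle `φ`. As long as the queries of `M` have length at most `x ≥ m`, the
answers `G φ b` have length at most `q x`, so that the next lookahead revision of `M` has length at
most `p (x + q x) + 1`. Hence all queries of `M` are bounded by a polynomial in `m` that is obtained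
by `r` iterations (`OracleMachine.HasStepCount.length_query_le_iterate`), and so is the total time.

On the level of machines, tapes have no end markers, so heads can return to the first cell and tapes
can be erased only with the help of a clock: a tape in unary notation that grows in each step of
the simulation or of copying, and therefore bounds positions and contents of all tapes in question
(`Clocked`); sweeps along the clock rewind and erase them (`exec_reset`). The answer
tape, the contents of which can be longer than the clock, need not be erased: until its first query,
`N` is given a work tape in its place, and thereafter each answer replaces the contents of the
proper one. The inflated query is written with the help of `k` tapes the head positions on which are
the digits of a reflected Gray code in base `n + 2`, so that one head moves by one cell in each step
(`exec_count`).

If the alphabet is empty, there is only one operator.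
-/

namespace TypeTwo

universe u

/-! ### Tapes -/

/-- Renaming of the auxiliary symbols in a cell. -/
def Cell.map {A : Type u} {B B' : Type} (f : B → B') : Cell A B → Cell A B' :=
  Option.map (Sum.map id f)

theorem Cell.letter?_map {A : Type u} {B B' : Type} (f : B → B') (c : Cell A B) :
    (Cell.map f c).letter? = c.letter? := by
  rcases c with _ | (x | y) <;> rfl

theorem Cell.map_injective {A : Type u} {B B' : Type} {f : B → B'} (hf : Function.Injective f) :
    Function.Injective (Cell.map (A := A) f) :=
  Option.map_injective (Function.injective_id.sumMap hf)

theorem Cell.eq_of_letter? {A : Type u} {B : Type} {c : Cell A B} {x : A}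
    (h : c.letter? = some x) : c = some (Sum.inl x) := by
  rcases c with _ | (y | y) <;> simp_all [Cell.letter?]

namespace Tape

variable {A : Type u} {B B' : Type}

theorem ext' {s t : Tape A B} (h₁ : s.cells = t.cells) (h₂ : s.head = t.head) : s = t := by
  cases s; cases t; simp_all

theorem writeMove_read_stay (t : Tape A B) : t.writeMove t.read Move.stay = t := by
  apply ext'
  · simp [writeMove, read]
  · rfl

theorem cells_writeMove_read (t : Tape A B) (m : Move) :
    (t.writeMove t.read m).cells = t.cells := by
  simp [writeMove, read]

/-- Renaming of the auxiliary symbols on a tape. -/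
def map (f : B → B') (t : Tape A B) : Tape A B' where
  cells i := Cell.map f (t.cells i)
  head := t.head

theorem read_map (f : B → B') (t : Tape A B) : (t.map f).read = Cell.map f t.read := rfl

theorem map_writeMove (f : B → B') (t : Tape A B) (c : Cell A B) (m : Move) :
    (t.writeMove c m).map f = (t.map f).writeMove (Cell.map f c) m := by
  apply ext'
  · funext i
    by_cases h : i = t.head
    · subst h; simp [map, writeMove]
    · simp [map, writeMove, Function.update_of_ne h]
  · rfl

theorem map_rewind (f : B → B') (t : Tape A B) : t.rewind.map f = (t.map f).rewind := rfl

theorem map_ofWord (f : B → B') (w : List A) : (ofWord w).map f = ofWord w := by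
  apply ext'
  · funext i
    simp only [map, ofWord]
    cases w[i]? <;> rfl
  · rfl

theorem word_map (f : B → B') (t : Tape A B) : (t.map f).word = t.word := by
  simp [word, map, Cell.letter?_map]

theorem word_rewind (t : Tape A B) : t.rewind.word = t.word := rfl

/-- The string on a tape is characterized by its letters and by the cell that terminates it. -/
theorem word_eq {t : Tape A B} {w : List A}
    (h : ∀ i ≤ w.length, (t.cells i).letter? = w[i]?) : t.word = w := by
  have hs : sInf {n | (t.cells n).letter? = none} = w.length := by
    apply le_antisymm
    · exact Nat.sInf_le (by simp [h])
    · apply le_csInf ⟨w.length, by simp [h]⟩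
      intro n hn
      by_contra! hlt
      have := h n hlt.le
      rw [Set.mem_ofPred_eq] at hn
      simp [hn] at this
      omega
  have ht : ∀ n ≤ w.length,
      (List.range n).filterMap (fun i => (t.cells i).letter?) = w.take n := by
    intro n
    induction n with
    | zero => simp
    | succ n ih =>
      intro hn
      rw [List.range_succ, List.filterMap_append, ih (by omega), List.take_add_one]
      simp only [List.filterMap_cons, List.filterMap_nil, h n (by omega)]
      cases w[n]? <;> rfl
  rw [word, hs, ht _ le_rfl, List.take_length]

/-- The head is at most at position `N`, and all cells from position `N` on are blank. -/
def BoundedBy (t : Tape A B) (N : ℕ) : Prop :=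
  t.head ≤ N ∧ ∀ i, N ≤ i → t.cells i = none

/-- On a tape with blanks from some cell on, the junk value `0` of the infimum in the definition of
`Tape.word` does not occur. -/
theorem word_spec {t : Tape A B} {N : ℕ} (h : ∀ i, N ≤ i → t.cells i = none) :
    ∀ i ≤ t.word.length, (t.cells i).letter? = t.word[i]? := by
  classical
  have hex : ∃ n, (t.cells n).letter? = none := ⟨N, by simp [h N le_rfl, Cell.letter?]⟩
  have hw : ∀ n, (∀ i < n, (t.cells i).letter? ≠ none) →
      ∃ w : List A, w.length = n ∧ ∀ i < n, (t.cells i).letter? = w[i]? := by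
    intro n
    induction n with
    | zero => exact fun _ => ⟨[], rfl, by simp⟩
    | succ n ih =>
      intro hn
      obtain ⟨w, hl, hw⟩ := ih fun i hi => hn i (by omega)
      obtain ⟨x, hx⟩ := Option.ne_none_iff_exists'.1 (hn n (by omega))
      refine ⟨w ++ [x], by simp [hl], fun i hi => ?_⟩
      rcases Nat.lt_succ_iff_lt_or_eq.1 hi with h' | rfl
      · rw [hw i h', List.getElem?_append_left (by omega)]
      · rw [hx, List.getElem?_append_right (by omega)]; simp [hl]
  obtain ⟨w, hl, hw⟩ := hw (Nat.find hex) fun i hi => Nat.find_min hex hi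
  have hw' : ∀ i ≤ w.length, (t.cells i).letter? = w[i]? := by
    intro i hi
    rcases hi.lt_or_eq with h' | rfl
    · exact hw i (by omega)
    · rw [hl, Nat.find_spec hex]; simp [← hl]
  rw [word_eq hw']
  exact hw'

theorem length_word_le {t : Tape A B} {N : ℕ} (h : ∀ i, N ≤ i → t.cells i = none) :
    t.word.length ≤ N := by
  by_contra! hlt
  have := word_spec h N hlt.le
  rw [h N le_rfl, List.getElem?_eq_getElem hlt] at this
  simp [Cell.letter?] at this

theorem cells_of_lt_word {t : Tape A B} {N : ℕ} (h : ∀ i, N ≤ i → t.cells i = none) {i : ℕ}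
    (hi : i < t.word.length) : t.cells i = some (Sum.inl t.word[i]) := by
  apply Cell.eq_of_letter?
  rw [word_spec h i hi.le, List.getElem?_eq_getElem hi]

namespace BoundedBy

theorem mono {t : Tape A B} {N N' : ℕ} (h : t.BoundedBy N) (hN : N ≤ N') : t.BoundedBy N' :=
  ⟨h.1.trans hN, fun i hi => h.2 i (hN.trans hi)⟩

theorem writeMove {t : Tape A B} {N : ℕ} (h : t.BoundedBy N) (c : Cell A B) (m : Move) :
    (t.writeMove c m).BoundedBy (N + 1) := by
  obtain ⟨h₁, h₂⟩ := h
  refine ⟨by cases m <;> simp [Tape.writeMove] <;> omega, fun i hi => ?_⟩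
  have hne : i ≠ t.head := by omega
  simpa [Tape.writeMove, Function.update_of_ne hne] using h₂ i (by omega)

theorem rewind {t : Tape A B} {N : ℕ} (h : t.BoundedBy N) : t.rewind.BoundedBy N :=
  ⟨Nat.zero_le _, h.2⟩

theorem ofWord_nil (N : ℕ) : (ofWord [] : Tape A B).BoundedBy N :=
  ⟨Nat.zero_le _, fun i _ => by simp [ofWord]⟩

end BoundedBy

/-- The tape on which the string `w` has just been written from left to right. -/
def typed (w : List A) : Tape A B where
  cells i := (w[i]?).map Sum.inl
  head := w.length

theorem rewind_typed (w : List A) : (typed w : Tape A B).rewind = ofWord w := rfl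

theorem typed_writeMove (w : List A) (x : A) :
    (typed w : Tape A B).writeMove (some (Sum.inl x)) Move.right = typed (w ++ [x]) := by
  apply ext'
  · funext i
    rcases lt_trichotomy i w.length with h | rfl | h
    · simp [typed, writeMove, Function.update_of_ne h.ne, List.getElem?_append_left h]
    · simp [typed, writeMove]
    · simp [typed, writeMove, Function.update_of_ne h.ne', List.getElem?_eq_none h.le,
        List.getElem?_append_right h.le,
        List.getElem?_eq_none (show [x].length ≤ i - w.length by simp; omega)]
  · simp [typed, writeMove]

theorem word_typed (w : List A) : (typed w : Tape A B).word = w := by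
  apply word_eq
  intro i _
  simp only [typed]
  cases w[i]? <;> rfl

/-- Writing blanks from left to right, starting at cell `0`. -/
theorem erase_iterate (t : Tape A B) (ht : t.head = 0) (n : ℕ) :
    (fun t : Tape A B => t.writeMove none Move.right)^[n] t =
      { cells := fun i => if i < n then none else t.cells i, head := n } := by
  induction n with
  | zero => exact ext' (by simp) (by simp [ht])
  | succ n ih =>
    rw [Function.iterate_succ_apply', ih]
    apply ext'
    · funext i
      by_cases h : i = n
      · subst h; simp [writeMove]
      · simp only [writeMove, Function.update_of_ne h]
        exact if_congr (by omega) rfl rfl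
    · rfl

theorem left_iterate (t : Tape A B) (n : ℕ) :
    (fun t : Tape A B => t.writeMove t.read Move.left)^[n] t =
      { cells := t.cells, head := t.head - n } := by
  induction n with
  | zero => rfl
  | succ n ih =>
    rw [Function.iterate_succ_apply', ih]
    apply ext'
    · simp [writeMove, read]
    · simp [writeMove]; omega

theorem right_iterate (t : Tape A B) (n : ℕ) :
    (fun t : Tape A B => t.writeMove t.read Move.right)^[n] t =
      { cells := t.cells, head := t.head + n } := by
  induction n with
  | zero => rfl
  | succ n ih =>
    rw [Function.iterate_succ_apply', ih]
    apply ext'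
    · simp [writeMove, read]
    · simp [writeMove]; omega

end Tape

/-! ### Traces of oracle machines -/

namespace OracleMachine

variable {A : Type u} {M : OracleMachine A} {φ : Baire A}

/-- `M.Exec φ c l c'`: with oracle `φ` the machine gets from `c` to `c'` in `l.length` steps, and
`l` lists, step by step, the queries posed (`none` for a step without query). -/
inductive Exec (M : OracleMachine A) (φ : Baire A) :
    M.Config → List (Option (List A)) → M.Config → Prop
  | nil (c : M.Config) : Exec M φ c [] c
  | cons {c c' c'' : M.Config} {l : List (Option (List A))} :
      M.step φ c = some c' → Exec M φ c' l c'' → Exec M φ c (M.queryOf c :: l) c''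

theorem Exec.append {c c' c'' : M.Config} {l l' : List (Option (List A))}
    (h : M.Exec φ c l c') (h' : M.Exec φ c' l' c'') : M.Exec φ c (l ++ l') c'' := by
  induction h with
  | nil c => exact h'
  | cons hs _ ih => exact Exec.cons hs (ih h')

theorem Exec.single {c c' : M.Config} (h : M.step φ c = some c') :
    M.Exec φ c [M.queryOf c] c' := Exec.cons h (Exec.nil _)

theorem exec_of_advance {c c' : M.Config} (h : M.advance c = some c')
    (hs : c'.state ≠ M.oracleState) : M.Exec φ c [none] c' := by
  have h1 : M.step φ c = some c' := by simp [step, h, hs]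
  have h2 : M.queryOf c = none := by simp [queryOf, h, hs]
  exact h2 ▸ Exec.single h1

theorem exec_of_advance_oracle {c c' : M.Config} (h : M.advance c = some c')
    (hs : c'.state = M.oracleState) :
    M.Exec φ c [some (c'.tape TapeName.query).word] (M.answer φ c') := by
  have h1 : M.step φ c = some (M.answer φ c') := by simp [step, h, hs]
  have h2 : M.queryOf c = some (c'.tape TapeName.query).word := by simp [queryOf, h, hs]
  exact h2 ▸ Exec.single h1

/-- The trace of an initial segment of a run. -/
theorem exec_run (a : List A) (t : ℕ) (h : ∀ s < t, M.step φ (M.run φ a s) ≠ none) :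
    M.Exec φ (M.init a) ((List.range t).map (M.queryAt φ a)) (M.run φ a t) := by
  induction t with
  | zero => exact Exec.nil _
  | succ t ih =>
    rw [List.range_succ, List.map_append]
    refine (ih fun s hs => h s (by omega)).append ?_
    obtain ⟨c, hc⟩ := Option.ne_none_iff_exists'.1 (h t (by omega))
    have : M.run φ a (t + 1) = c := by simp [run, hc]
    rw [this]
    exact Exec.single hc

theorem Exec.run_eq {c c' : M.Config} {l : List (Option (List A))} (h : M.Exec φ c l c')
    {a : List A} {s : ℕ} (hc : M.run φ a s = c) :
    M.run φ a (s + l.length) = c' ∧ ∀ t < l.length,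
      M.step φ (M.run φ a (s + t)) ≠ none ∧ l[t]? = some (M.queryAt φ a (s + t)) := by
  induction h generalizing s with
  | nil c => simpa using hc
  | @cons c c' c'' l hs _ ih =>
    have h1 : M.run φ a (s + 1) = c' := by simp [run, hc, hs]
    obtain ⟨ih1, ih2⟩ := ih h1
    refine ⟨by rw [← ih1, List.length_cons]; congr 1; omega, fun t ht => ?_⟩
    cases t with
    | zero => simp [hc, hs, queryAt]
    | succ t =>
      have := ih2 t (by simpa using ht)
      rw [show s + (t + 1) = s + 1 + t by omega]
      simpa using this

/-- A trace that starts in an initial configuration is that of an initial segment of a run. -/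
theorem Exec.from_init {c : M.Config} {a : List A} {l : List (Option (List A))}
    (h : M.Exec φ (M.init a) l c) :
    M.run φ a l.length = c ∧ (∀ t < l.length, M.step φ (M.run φ a t) ≠ none) ∧
      l = (List.range l.length).map (M.queryAt φ a) := by
  obtain ⟨h1, h2⟩ := h.run_eq (s := 0) (a := a) rfl
  simp only [Nat.zero_add] at h1 h2
  refine ⟨h1, fun t ht => (h2 t ht).1, ?_⟩
  apply List.ext_getElem?
  intro t
  by_cases ht : t < l.length
  · rw [(h2 t ht).2]
    simp [ht]
  · simp [ht]

theorem step_eq_none {c : M.Config} : M.step φ c = none ↔ M.advance c = none := by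
  simp [step]

theorem queryAt_of_halted {a : List A} {T t : ℕ} (h : M.step φ (M.run φ a T) = none)
    (ht : T ≤ t) : M.queryAt φ a t = none := by
  have : ∀ n, M.run φ a (T + n) = M.run φ a T := by
    intro n
    induction n with
    | zero => rfl
    | succ n ih =>
      rw [← Nat.add_assoc, run, ih, h]
      rfl
  obtain ⟨n, rfl⟩ := Nat.exists_eq_add_of_le ht
  rw [queryAt, this, queryOf, step_eq_none.1 h]
  rfl

/-- The answer tape is excluded, since it can receive an answer of any length in one step. -/
theorem exec_boundedBy {c c' : M.Config} {l : List (Option (List A))} (h : M.Exec φ c l c')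
    {i : TapeName M.Work} (hi : i ≠ TapeName.answer) {N : ℕ} (hc : (c.tape i).BoundedBy N) :
    (c'.tape i).BoundedBy (N + l.length) := by
  induction h generalizing N with
  | nil c => simpa using hc
  | @cons c c' c'' l hs _ ih =>
    suffices h : (c'.tape i).BoundedBy (N + 1) by
      have := ih h
      rwa [List.length_cons, Nat.add_comm l.length, ← Nat.add_assoc]
    simp only [step, advance, Option.map_map, Option.map_eq_some_iff, Function.comp] at hs
    obtain ⟨p, -, rfl⟩ := hs
    split_ifs with ho
    · cases i with
      | answer => exact absurd rfl hi
      | query => exact (hc.writeMove _ _).rewind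
      | _ => exact hc.writeMove _ _
    · exact hc.writeMove _ _

theorem length_query_le {a : List A} {t : ℕ} (h : ∀ s < t, M.step φ (M.run φ a s) ≠ none)
    {b : List A} (hb : M.queryAt φ a t = some b) : b.length ≤ t + 1 := by
  have h1 := exec_boundedBy (exec_run a t h) (i := TapeName.query) (by simp) (N := 0)
    (Tape.BoundedBy.ofWord_nil 0)
  simp only [queryAt, queryOf, advance, Option.bind_map] at hb
  obtain ⟨s, -, hs⟩ := Option.bind_eq_some_iff.1 hb
  simp only [Function.comp] at hs
  split_ifs at hs with ho
  rw [← Option.some.inj hs]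
  simpa using Tape.length_word_le (h1.writeMove (s.2 TapeName.query).1 (s.2 TapeName.query).2).2

theorem length_output_le {a : List A} {t : ℕ} (h : ∀ s < t, M.step φ (M.run φ a s) ≠ none) :
    ((M.run φ a t).tape TapeName.output).word.length ≤ t := by
  have h1 := exec_boundedBy (exec_run a t h) (i := TapeName.output) (by simp) (N := 0)
    (Tape.BoundedBy.ofWord_nil 0)
  simpa using Tape.length_word_le h1.2

/-! ### Step-counts on initial segments of a run -/

theorem run_congr {φ ψ : Baire A} {a : List A} {t : ℕ}
    (h : ∀ s < t, ∀ b, M.queryAt φ a s = some b → ψ b = φ b) : M.run ψ a t = M.run φ a t := by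
  induction t with
  | zero => rfl
  | succ t ih =>
    have ih := ih fun s hs => h s (by omega)
    rw [run, run, ih]
    suffices M.step ψ (M.run φ a t) = M.step φ (M.run φ a t) by rw [this]
    have ht := h t (by omega)
    simp only [queryAt, queryOf] at ht
    simp only [step]
    cases hc : M.advance (M.run φ a t) with
    | none => rfl
    | some c' =>
      simp only [hc, Option.bind_some] at ht
      simp only [Option.map_some]
      split_ifs with ho
      · simp only [ho, if_true] at ht
        have := ht _ rfl
        simp only [answer, this]
      · rfl

theorem HaltsIn.unique {a : List A} {T T' : ℕ} (h : M.HaltsIn φ a T) (h' : M.HaltsIn φ a T') :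
    T = T' := by
  rcases lt_trichotomy T T' with hlt | rfl | hlt
  · exact absurd h.1 (h'.2 _ hlt)
  · rfl
  · exact absurd h'.1 (h.2 _ hlt)

theorem maxLength_le_iff {a : List A} {T n : ℕ} :
    M.maxLength φ a T ≤ n ↔ a.length ≤ n ∧
      ∀ t < T, ∀ b, M.queryAt φ a t = some b → (φ b).length ≤ n := by
  simp only [maxLength, max_le_iff, Finset.sup_le_iff, Finset.mem_range]
  refine and_congr_right fun _ => forall₂_congr fun t _ => ?_
  cases M.queryAt φ a t <;> simp

/-- A step-count bounds every initial segment of a run in terms of the answers received in this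
segment only: the machine cannot notice if all other values of the oracle are replaced by the
empty string. -/
theorem HasStepCount.le_of_not_halted {s : ℕ → ℕ} (hs : M.HasStepCount s) (hmono : Monotone s)
    {a : List A} {t : ℕ} (h : ∀ s < t, M.step φ (M.run φ a s) ≠ none) :
    t ≤ s (M.maxLength φ a t) := by
  classical
  -- the oracle that agrees with `φ` on the queries posed so far, and is empty elsewhere
  let ψ : Baire A := fun b => if ∃ s < t, M.queryAt φ a s = some b then φ b else []
  have hψ : ∀ s < t, ∀ b, M.queryAt φ a s = some b → ψ b = φ b :=
    fun s hst b hb => if_pos ⟨s, hst, hb⟩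
  have hrun : ∀ s ≤ t, M.run ψ a s = M.run φ a s :=
    fun s hst => run_congr fun s' hs' => hψ s' (by omega)
  obtain ⟨T, hT, hle⟩ := hs ψ a
  have htT : t ≤ T := by
    by_contra! hlt
    have := h T hlt
    rw [← hrun T hlt.le] at this
    apply this
    have h0 := hT.1
    rw [step_eq_none] at h0 ⊢
    exact h0
  refine htT.trans (hle.trans (hmono ?_))
  have hφ := (maxLength_le_iff (M := M) (φ := φ) (a := a) (T := t)).1 le_rfl
  rw [maxLength_le_iff]
  refine ⟨hφ.1, fun s _ b _ => ?_⟩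
  by_cases hb : ∃ s < t, M.queryAt φ a s = some b
  · obtain ⟨s', hs', hb'⟩ := hb
    rw [hψ s' hs' b hb']
    exact hφ.2 s' hs' b hb'
  · simp only [ψ, if_neg hb]
    simp

/-- If at most one lookahead revision happens, then no query is longer than the bound on the first
one, which depends on the size of the input only. -/
theorem length_query_le_of_lookaheadRevisionLE_one {s : ℕ → ℕ} (hs : M.HasStepCount s)
    (hmono : Monotone s) (h1 : M.LookaheadRevisionLE 1) {a : List A} {T : ℕ}
    (hT : ∀ t < T, M.step φ (M.run φ a t) ≠ none) {t : ℕ} (ht : t < T) {b : List A}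
    (hb : M.queryAt φ a t = some b) : b.length ≤ s a.length + 1 := by
  classical
  have hex : ∃ t, M.queryAt φ a t ≠ none := ⟨t, by simp [hb]⟩
  obtain ⟨b₀, hb₀⟩ := Option.ne_none_iff_exists'.1 (Nat.find_spec hex)
  have hmin : ∀ s < Nat.find hex, M.queryAt φ a s = none := fun s hs => by
    simpa using Nat.find_min hex hs
  have hfirst : b₀.length ≤ s a.length + 1 := by
    have hfT : Nat.find hex < T := (Nat.find_min' hex (by simp [hb])).trans_lt ht
    have hnh : ∀ s < Nat.find hex, M.step φ (M.run φ a s) ≠ none :=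
      fun s hs => hT s (by omega)
    have h2 := length_query_le hnh hb₀
    have h3 := hs.le_of_not_halted hmono hnh
    have h4 : M.maxLength φ a (Nat.find hex) ≤ a.length :=
      maxLength_le_iff.2 ⟨le_rfl, fun s hs b hb => by simp [hmin s hs] at hb⟩
    have := hmono h4
    omega
  by_contra! hlong
  have hex' : ∃ t, ∃ b, M.queryAt φ a t = some b ∧ s a.length + 1 < b.length := ⟨t, b, hb, hlong⟩
  obtain ⟨b₁, hb₁, hl₁⟩ := Nat.find_spec hex'
  have hne : Nat.find hex ≠ Nat.find hex' := by
    intro he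
    rw [he, hb₁] at hb₀
    have := Option.some.inj hb₀
    subst this
    omega
  have hsub : {Nat.find hex, Nat.find hex'} ⊆ M.lookaheadRevisions φ a := by
    rintro x (rfl | rfl)
    · exact ⟨b₀, hb₀, fun s hs b' hb' => by simp [hmin s hs] at hb'⟩
    · refine ⟨b₁, hb₁, fun s hs b' hb' => ?_⟩
      have := Nat.find_min hex' hs
      simp only [not_exists, not_and, not_lt] at this
      exact (this b' hb').trans_lt hl₁
  have := (Set.encard_le_encard hsub).trans (h1 φ a)
  rw [Set.encard_pair hne] at this
  exact absurd this (by decide)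

/-! ### Counting lookahead revisions -/

/-- The size of the query posed in a step, increased by one to distinguish the empty query from
the absence of a query. -/
def querySize : Option (List A) → ℕ
  | none => 0
  | some b => b.length + 1

/-- The state consists of the largest number seen so far and of the number of strict increases of
this maximum. -/
def recordStep (s : ℕ × ℕ) (x : ℕ) : ℕ × ℕ := if s.1 < x then (x, s.2 + 1) else s

/-- The maximal query size and the number of lookahead revisions in a trace that follows on one
with the values `s`. -/
def records (s : ℕ × ℕ) (l : List (Option (List A))) : ℕ × ℕ :=
  (l.map querySize).foldl recordStep s

theorem records_append (s : ℕ × ℕ) (l l' : List (Option (List A))) :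
    records s (l ++ l') = records (records s l) l' := by
  simp [records]

theorem records_of_le {s : ℕ × ℕ} {l : List (Option (List A))}
    (h : ∀ x ∈ l, querySize x ≤ s.1) : records s l = s := by
  induction l with
  | nil => rfl
  | cons x l ih =>
    have hx : recordStep s (querySize x) = s := if_neg (by have := h x (by simp); omega)
    have := ih fun y hy => h y (by simp [hy])
    simp only [records, List.map_cons, List.foldl_cons, hx] at this ⊢
    exact this

theorem records_replicate_none (s : ℕ × ℕ) (n : ℕ) :
    records s (List.replicate n (none : Option (List A))) = s :=
  records_of_le fun x hx => by simp [(List.mem_replicate.1 hx).2, querySize]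

theorem records_singleton (s : ℕ × ℕ) (x : Option (List A)) :
    records s [x] = recordStep s (querySize x) := rfl

theorem mem_lookaheadRevisions {a : List A} {t : ℕ} :
    t ∈ M.lookaheadRevisions φ a ↔ 0 < querySize (M.queryAt φ a t) ∧
      ∀ s < t, querySize (M.queryAt φ a s) < querySize (M.queryAt φ a t) := by
  simp only [lookaheadRevisions, Set.mem_ofPred_eq]
  cases M.queryAt φ a t with
  | none => simp [querySize]
  | some b =>
    simp only [Option.some.injEq, exists_eq_left']
    refine ⟨fun h => ⟨by simp [querySize], fun s hs => ?_⟩, fun h s hs b' hb' => ?_⟩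
    · have := h s hs
      cases hq : M.queryAt φ a s with
      | none => simp [querySize]
      | some b' => simpa [querySize] using this b' hq
    · simpa [hb', querySize] using h.2 s hs

/-- The value of `records` on an initial segment of a run counts the positions of the strict records
in the sequence of query sizes. -/
theorem records_range (u : ℕ → Option (List A)) (n : ℕ) :
    records (0, 0) ((List.range n).map u) =
      ((Finset.range n).sup fun t => querySize (u t),
        ((Finset.range n).filter fun t => 0 < querySize (u t) ∧
          ∀ s < t, querySize (u s) < querySize (u t)).card) := by
  induction n with
  | zero => rfl
  | succ n ih =>
    rw [List.range_succ, List.map_append, records_append, ih, List.map_singleton,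
      records_singleton, Finset.range_add_one, Finset.sup_insert, Finset.filter_insert, recordStep]
    dsimp only
    have key : (Finset.range n).sup (fun t => querySize (u t)) < querySize (u n) ↔
        0 < querySize (u n) ∧ ∀ s < n, querySize (u s) < querySize (u n) := by
      constructor
      · intro h
        exact ⟨by omega, fun s hs => (Finset.le_sup (f := fun t => querySize (u t))
          (Finset.mem_range.2 hs)).trans_lt h⟩
      · rintro ⟨h0, h⟩
        rw [Finset.sup_lt_iff (by simpa using h0)]
        exact fun s hs => h s (Finset.mem_range.1 hs)
    by_cases h : (Finset.range n).sup (fun t => querySize (u t)) < querySize (u n)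
    · rw [if_pos h, if_pos (key.1 h), Finset.card_insert_of_notMem (by simp)]
      simp [h.le]
    · rw [if_neg h, if_neg (mt key.2 h)]
      simp [not_lt.1 h]

theorem records_snd_le {r : ℕ} (h : M.LookaheadRevisionLE r) (φ : Baire A) (a : List A) (n : ℕ) :
    (records (0, 0) ((List.range n).map (M.queryAt φ a))).2 ≤ r := by
  rw [records_range]
  dsimp only
  have h1 : (((Finset.range n).filter fun t => 0 < querySize (M.queryAt φ a t) ∧
      ∀ s < t, querySize (M.queryAt φ a s) < querySize (M.queryAt φ a t)) : Set ℕ) ⊆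
      M.lookaheadRevisions φ a := by
    intro t ht
    exact mem_lookaheadRevisions.2 (Finset.mem_filter.1 ht).2
  have h2 := (Set.encard_le_encard h1).trans (h φ a)
  rw [Set.encard_coe_eq_coe_finsetCard] at h2
  exact_mod_cast h2

theorem encard_lookaheadRevisions_le {a : List A} {T r : ℕ}
    (hT : M.step φ (M.run φ a T) = none)
    (h : (records (0, 0) ((List.range T).map (M.queryAt φ a))).2 ≤ r) :
    (M.lookaheadRevisions φ a).encard ≤ r := by
  rw [records_range] at h
  dsimp only at h
  have h1 : M.lookaheadRevisions φ a ⊆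
      (((Finset.range T).filter fun t => 0 < querySize (M.queryAt φ a t) ∧
        ∀ s < t, querySize (M.queryAt φ a s) < querySize (M.queryAt φ a t)) : Set ℕ) := by
    intro t ht
    have ht' := mem_lookaheadRevisions.1 ht
    refine Finset.mem_coe.2 (Finset.mem_filter.2 ⟨Finset.mem_range.2 ?_, ht'⟩)
    by_contra! hle
    have := ht'.1
    simp [queryAt_of_halted hT hle, querySize] at this
  refine (Set.encard_le_encard h1).trans ?_
  rw [Set.encard_coe_eq_coe_finsetCard]
  exact_mod_cast h

end OracleMachine

/-! ### The composite machine -/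

/-- The work tapes of the composite of an outer machine with work tapes `V` and an inner machine
with work tapes `W`. The outer machine keeps its input and output tape, its query and answer tape
become work tapes. The inner machine keeps its query tape, its input and output tape become work
tapes, and until its first query also its answer tape is a work tape. -/
inductive CompWork (V W : Type) (k : ℕ) : Type
  | clock
  | outer (v : V)
  | outerQuery
  | outerAnswer
  | innerInput
  | innerOutput
  | innerAnswer
  | inner (w : W)
  | digit (j : Fin k)

/-- The occasions for a reset of the auxiliary tapes: the outer machine has posed a query, the
inflated query has been answered, the inner machine has halted, its output has been copied. -/
inductive Stage : Type
  | call
  | ask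
  | fetch
  | ret

/-- The states of the composite machine: simulation of the outer machine (`outer`) and of the inner
machine (`inner`, with a flag that says whether it has already posed a query), the two directions of
the sweeps in a reset (`back` and `forth`, with a flag for the second pair), the copying of a query
to the input tape of the inner machine (`prep` and `copyIn`), the writing of the inflated query
(`count`), and the copying of the result to the answer tape of the outer machine (`copyOut`). -/
inductive CompState (S S' : Type) (k : ℕ) : Type
  | boot
  | outer (s : S)
  | back (p : Stage) (b : Bool)
  | forth (p : Stage) (b : Bool)
  | prep
  | copyIn
  | count (dir : Fin k → Bool)
  | inner (s : S') (asked : Bool)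
  | copyOut

instance {V W : Type} [Finite V] [Finite W] {k : ℕ} : Finite (CompWork V W k) := by
  refine Finite.of_injective (β := Fin 6 ⊕ V ⊕ W ⊕ Fin k) (fun
    | .clock => .inl 0
    | .outer v => .inr (.inl v)
    | .outerQuery => .inl 1
    | .outerAnswer => .inl 2
    | .innerInput => .inl 3
    | .innerOutput => .inl 4
    | .innerAnswer => .inl 5
    | .inner w => .inr (.inr (.inl w))
    | .digit j => .inr (.inr (.inr j))) ?_
  intro x y h
  cases x <;> cases y <;> simp_all

instance : Finite Stage := by
  refine Finite.of_injective (β := Fin 4) (fun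
    | .call => 0
    | .ask => 1
    | .fetch => 2
    | .ret => 3) ?_
  intro x y h
  cases x <;> cases y <;> simp_all

instance {S S' : Type} [Finite S] [Finite S'] {k : ℕ} : Finite (CompState S S' k) := by
  refine Finite.of_injective
    (β := Fin 4 ⊕ S ⊕ (Stage × Bool × Bool) ⊕ (Fin k → Bool) ⊕ (S' × Bool)) (fun
    | .boot => .inl 0
    | .outer s => .inr (.inl s)
    | .back p b => .inr (.inr (.inl (p, b, false)))
    | .forth p b => .inr (.inr (.inl (p, b, true)))
    | .prep => .inl 1
    | .copyIn => .inl 2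
    | .count d => .inr (.inr (.inr (.inl d)))
    | .inner s b => .inr (.inr (.inr (.inr (s, b))))
    | .copyOut => .inl 3) ?_
  intro x y h
  cases x <;> cases y <;> simp_all

/-- The auxiliary symbols of the composite machine: those of both machines and two marks. -/
abbrev CompAux (B B' : Type) : Type := B ⊕ B' ⊕ Bool

/-- The mark for the left end of a tally tape (`true`) and the tally mark (`false`). -/
def mark {A : Type u} {B B' : Type} (b : Bool) : Cell A (CompAux B B') :=
  some (Sum.inr (Sum.inr (Sum.inr b)))

/-- The tape with the number `L` in unary, following on a mark for the left end, and with the head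
on cell `h`. -/
def tally {A : Type u} {B B' : Type} (L h : ℕ) : Tape A (CompAux B B') where
  cells i := if i = 0 then mark true else if i ≤ L then mark false else none
  head := h

section Tally

variable {A : Type u} {B B' : Type}

theorem tally_read_eq_mark {L h : ℕ} :
    (tally L h : Tape A (CompAux B B')).read = mark true ↔ h = 0 := by
  simp only [Tape.read, tally]
  split_ifs <;> simp_all [mark]

theorem tally_read_eq_none {L h : ℕ} :
    (tally L h : Tape A (CompAux B B')).read = none ↔ L < h := by
  simp only [Tape.read, tally]
  split_ifs <;> simp_all [mark]

theorem tally_cells_succ (L : ℕ) :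
    Function.update (tally L (L + 1) : Tape A (CompAux B B')).cells (L + 1) (mark false) =
      (tally (L + 1) (L + 1) : Tape A (CompAux B B')).cells := by
  funext i
  by_cases h : i = L + 1
  · subst h; simp [tally]
  · simp only [Function.update_of_ne h, tally]
    split_ifs <;> first | rfl | omega

theorem tally_writeMove_right (L : ℕ) :
    (tally L (L + 1) : Tape A (CompAux B B')).writeMove (mark false) Move.right =
      tally (L + 1) (L + 2) :=
  Tape.ext' (tally_cells_succ L) rfl

theorem tally_writeMove_stay (L : ℕ) :
    (tally L (L + 1) : Tape A (CompAux B B')).writeMove (mark false) Move.stay =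
      tally (L + 1) (L + 1) :=
  Tape.ext' (tally_cells_succ L) rfl

theorem ofWord_nil_writeMove_mark :
    (Tape.ofWord [] : Tape A (CompAux B B')).writeMove (mark true) Move.right = tally 0 1 := by
  apply Tape.ext'
  · funext i
    by_cases h : i = 0
    · subst h; simp [tally, Tape.writeMove, Tape.ofWord]
    · simp [tally, Tape.writeMove, Tape.ofWord, h]
  · rfl

end Tally

section Composite

variable {A : Type u} (M N : OracleMachine A) (k : ℕ) (x₀ : A)

/-- The names of the tapes of the composite machine. -/
abbrev CompTape : Type := TapeName (CompWork M.Work N.Work k)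

/-- The cells of the composite machine. -/
abbrev CompCell : Type u := Cell A (CompAux M.Aux N.Aux)

/-- An action of the composite machine on its tapes. -/
abbrev CompAct : Type u := CompTape M N k → CompCell M N × Move

variable {M N k}

/-- The clock. Its length bounds head positions and contents of all scratch tapes. -/
abbrev clk : CompTape M N k := TapeName.work CompWork.clock

/-- The query tape of the outer machine. -/
abbrev oq : CompTape M N k := TapeName.work CompWork.outerQuery

/-- The tapes that are rewound and, if not kept, erased in a reset. The proper answer tape is not
among them, since its contents can be too long. -/
def isScratch : CompTape M N k → Bool
  | .query => true
  | .work .outerQuery => true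
  | .work .outerAnswer => true
  | .work .innerInput => true
  | .work .innerOutput => true
  | .work .innerAnswer => true
  | .work (.inner _) => true
  | .work (.digit _) => true
  | _ => false

/-- The tapes that are used in the simulation of the outer machine only. -/
def isMain : CompTape M N k → Bool
  | .input => true
  | .output => true
  | .work (.outer _) => true
  | _ => false

/-- The scratch tapes that are not erased in the reset at a given stage. -/
def keeps : Stage → CompTape M N k → Bool
  | _, .work .outerQuery => true
  | .ask, .work .innerInput => true
  | .fetch, .work .innerOutput => true
  | .ret, .work .outerAnswer => true
  | _, _ => false

/-- The tapes of the outer machine among those of the composite machine. -/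
def outerName : TapeName M.Work → CompTape M N k
  | .input => .input
  | .output => .output
  | .query => .work .outerQuery
  | .answer => .work .outerAnswer
  | .work v => .work (.outer v)

/-- The tapes of the inner machine among those of the composite machine. -/
def innerName (asked : Bool) : TapeName N.Work → CompTape M N k
  | .input => .work .innerInput
  | .output => .work .innerOutput
  | .query => .query
  | .answer => if asked then .answer else .work .innerAnswer
  | .work w => .work (.inner w)

/-- Symbols of the outer machine as symbols of the composite machine. -/
abbrev outerCell : Cell A M.Aux → CompCell M N := Cell.map Sum.inl

/-- Symbols of the inner machine as symbols of the composite machine. -/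
abbrev innerCell : Cell A N.Aux → CompCell M N := Cell.map (Sum.inr ∘ Sum.inl)

/-- The action that changes nothing. -/
def idle (rd : CompTape M N k → CompCell M N) : CompAct M N k := fun i => (rd i, .stay)

/-- The action that puts the left end mark on the clock. -/
def bootAct (rd : CompTape M N k → CompCell M N) : CompAct M N k
  | .work .clock => (mark true, .right)
  | i => (rd i, .stay)

/-- A step of the outer machine, in which the clock advances. -/
def outerAct (a : TapeName M.Work → Cell A M.Aux × Move)
    (rd : CompTape M N k → CompCell M N) : CompAct M N k
  | .input => (outerCell (a .input).1, (a .input).2)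
  | .output => (outerCell (a .output).1, (a .output).2)
  | .work .outerQuery => (outerCell (a .query).1, (a .query).2)
  | .work .outerAnswer => (outerCell (a .answer).1, (a .answer).2)
  | .work (.outer v) => (outerCell (a (.work v)).1, (a (.work v)).2)
  | .work .clock => (mark false, .right)
  | i => (rd i, .stay)

/-- A step of the inner machine, in which the clock advances. -/
def innerAct (asked : Bool) (a : TapeName N.Work → Cell A N.Aux × Move)
    (rd : CompTape M N k → CompCell M N) : CompAct M N k
  | .query => (innerCell (a .query).1, (a .query).2)
  | .answer => if asked then (innerCell (a .answer).1, (a .answer).2) else (rd .answer, .stay)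
  | .work .innerInput => (innerCell (a .input).1, (a .input).2)
  | .work .innerOutput => (innerCell (a .output).1, (a .output).2)
  | .work .innerAnswer => if asked then (rd (.work .innerAnswer), .stay) else
      (innerCell (a .answer).1, (a .answer).2)
  | .work (.inner w) => (innerCell (a (.work w)).1, (a (.work w)).2)
  | .work .clock => (mark false, .right)
  | i => (rd i, .stay)

/-- The clock and all scratch tapes move left. -/
def backAct (rd : CompTape M N k → CompCell M N) : CompAct M N k
  | .work .clock => (rd clk, .left)
  | i => if isScratch i then (rd i, .left) else (rd i, .stay)

/-- The clock moves right, and in the first sweep (`b = false`) so do the scratch tapes that are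
not kept, which are erased thereby. -/
def forthAct (p : Stage) (b : Bool) (rd : CompTape M N k → CompCell M N) : CompAct M N k
  | .work .clock => (rd clk, .right)
  | i => if b = false ∧ isScratch i = true ∧ keeps p i = false then (none, .right)
      else (rd i, .stay)

/-- The left end marks are put on the digit tapes. -/
def prepAct (rd : CompTape M N k → CompCell M N) : CompAct M N k
  | .work .clock => (mark false, .right)
  | .work (.digit _) => (mark true, .right)
  | i => (rd i, .stay)

/-- A letter `x` of the query is copied to the input tape of the inner machine, and counted on the
digit tapes. -/
def copyInAct (x : A) (rd : CompTape M N k → CompCell M N) : CompAct M N k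
  | .work .clock => (mark false, .right)
  | .work .outerQuery => (rd oq, .right)
  | .work .innerInput => (some (.inl x), .right)
  | .work (.digit _) => (mark false, .right)
  | i => (rd i, .stay)

/-- Only the clock advances. -/
def tickAct (m : Move) (rd : CompTape M N k → CompCell M N) : CompAct M N k
  | .work .clock => (mark false, m)
  | i => (rd i, .stay)

/-- A letter is added to the inflated query, and the head of the digit tape `j` moves on in the
direction `d`. -/
def countAct (j : Fin k) (d : Bool) (rd : CompTape M N k → CompCell M N) :
    CompAct M N k
  | .query => (some (.inl x₀), .right)
  | .work .clock => (mark false, .right)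
  | .work (.digit i) =>
    (rd (.work (.digit i)), if i = j then (if d then .right else .left) else .stay)
  | i => (rd i, .stay)

/-- A letter `x` is copied from the output tape of the inner machine to the answer tape of the outer
machine. -/
def copyOutAct (x : A) (rd : CompTape M N k → CompCell M N) : CompAct M N k
  | .work .clock => (mark false, .right)
  | .work .innerOutput => (rd (.work .innerOutput), .right)
  | .work .outerAnswer => (some (.inl x), .right)
  | i => (rd i, .stay)

/-- The head of digit tape `j` has reached the end of the tape in the direction `dir j`. -/
def AtEnd (dir : Fin k → Bool) (rd : CompTape M N k → CompCell M N) (j : Fin k) : Prop :=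
  if dir j then rd (.work (.digit j)) = none else rd (.work (.digit j)) = mark true

/-- The state that follows on a reset. -/
def afterReset : Stage → CompState M.State N.State k
  | .call => .prep
  | .ask => .inner N.start false
  | .fetch => .copyOut
  | .ret => .outer M.oracleState

open Classical in
/-- The transition function of the composite machine. The digit tapes implement a reflected Gray
code with `k` digits: in each step of the state `count`, the least digit that has not arrived at
its end moves on, and the lower digits reverse their directions. -/
noncomputable def compTrans :
    CompState M.State N.State k → (CompTape M N k → CompCell M N) →
      Option (CompState M.State N.State k × CompAct M N k)
  | .boot, rd => some (.outer M.start, bootAct rd)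
  | .outer s, rd =>
    (M.trans s fun i => Function.invFun outerCell (rd (outerName i))).map fun p =>
      (if p.1 = M.oracleState then .back .call false else .outer p.1, outerAct p.2 rd)
  | .back p b, rd =>
    if rd clk = mark true then some (.forth p b, idle rd) else some (.back p b, backAct rd)
  | .forth p b, rd =>
    if rd clk = none then some (if b then afterReset p else .back p true, idle rd)
    else some (.forth p b, forthAct p b rd)
  | .prep, rd => some (.copyIn, prepAct rd)
  | .copyIn, rd =>
    match (rd oq).letter? with
    | some x => some (.copyIn, copyInAct x rd)
    | none => some (.count fun _ => false, tickAct .right rd)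
  | .count dir, rd =>
    if h : ∃ j, ¬ AtEnd dir rd j ∧ ∀ i < j, AtEnd dir rd i then
      some (.count fun i => if i < h.choose then !dir i else dir i,
        countAct x₀ h.choose (dir h.choose) rd)
    else some (.inner N.oracleState true, tickAct .stay rd)
  | .inner s asked, rd =>
    -- the clock is not at its right end only if the answer is that to the inflated query
    if rd clk = none then
      match N.trans s fun i => Function.invFun innerCell (rd (innerName asked i)) with
      | some p => some (.inner p.1 (if p.1 = N.oracleState then true else asked),
          innerAct asked p.2 rd)
      | none => some (.back .fetch false, idle rd)
    else some (.back .ask false, idle rd)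
  | .copyOut, rd =>
    match (rd (.work .innerOutput)).letter? with
    | some x => some (.copyOut, copyOutAct x rd)
    | none => some (.back .ret false, idle rd)

variable (M N k)

/-- The composite machine runs the outer machine `M` and answers its queries by runs of the inner
machine `N`. Before such a run on an input of length `n` it poses a query that consists of
`(n + 2) ^ k - 1` letters `x₀`. -/
noncomputable abbrev composite : OracleMachine A :=
  have := M.finState
  have := M.finAux
  have := M.finWork
  have := N.finState
  have := N.finAux
  have := N.finWork
  { State := CompState M.State N.State k
    Aux := CompAux M.Aux N.Aux
    Work := CompWork M.Work N.Work k
    start := .boot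
    oracleState := .inner N.oracleState true
    trans := compTrans x₀ }

variable {M N k x₀}

/-- The tapes of the composite machine. -/
abbrev CompTapes (M N : OracleMachine A) (k : ℕ) : Type u :=
  CompTape M N k → Tape A (CompAux M.Aux N.Aux)

/-- The symbols under the heads. -/
abbrev reads (T : CompTapes M N k) : CompTape M N k → CompCell M N := fun i => (T i).read

/-- The effect of an action. -/
def act (T : CompTapes M N k) (a : CompAct M N k) : CompTapes M N k :=
  fun i => (T i).writeMove (a i).1 (a i).2

/-- The configuration of the composite machine with given state and tapes. -/
abbrev conf (q : CompState M.State N.State k) (T : CompTapes M N k) :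
    (composite M N k x₀).Config := ⟨q, T⟩

theorem act_idle (T : CompTapes M N k) : act T (idle (reads T)) = T := by
  funext i
  exact Tape.writeMove_read_stay _

variable {φ : Baire A}

theorem advance_conf {q q' : CompState M.State N.State k} {T : CompTapes M N k}
    {a : CompAct M N k} (h : compTrans x₀ q (reads T) = some (q', a)) :
    (composite M N k x₀).advance (conf q T) = some (conf q' (act T a)) := by
  simp only [OracleMachine.advance]
  erw [h]
  rfl

theorem exec_step {q q' : CompState M.State N.State k} {T : CompTapes M N k}
    {a : CompAct M N k} (h : compTrans x₀ q (reads T) = some (q', a))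
    (hq : q' ≠ .inner N.oracleState true) :
    (composite M N k x₀).Exec φ (conf q T) [none] (conf q' (act T a)) :=
  OracleMachine.exec_of_advance (advance_conf h) hq

/-- Repetition of a step that stays in the same state and poses no query. -/
theorem exec_loop {q : CompState M.State N.State k}
    {a : (CompTape M N k → CompCell M N) → CompAct M N k}
    (hq : q ≠ .inner N.oracleState true) (T : CompTapes M N k) (n : ℕ)
    (h : ∀ m < n, compTrans x₀ q (reads ((fun T => act T (a (reads T)))^[m] T)) =
      some (q, a (reads ((fun T => act T (a (reads T)))^[m] T)))) :
    (composite M N k x₀).Exec φ (conf q T) (List.replicate n none)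
      (conf q ((fun T => act T (a (reads T)))^[n] T)) := by
  induction n with
  | zero => exact OracleMachine.Exec.nil _
  | succ n ih =>
    rw [List.replicate_succ', Function.iterate_succ_apply']
    exact (ih fun m hm => h m (by omega)).append (exec_step (h n (by omega)) hq)

/-- If a step acts on the tape `i` independently of the other tapes, then so does its iteration. -/
theorem iterate_tape {step : CompTapes M N k → CompTapes M N k} {i : CompTape M N k}
    {f : Tape A (CompAux M.Aux N.Aux) → Tape A (CompAux M.Aux N.Aux)}
    (h : ∀ T, step T i = f (T i)) (n : ℕ) (T : CompTapes M N k) :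
    (step^[n] T) i = f^[n] (T i) := by
  induction n with
  | zero => rfl
  | succ n ih => rw [Function.iterate_succ_apply', Function.iterate_succ_apply', h, ih]

/-! ### Resets -/

/-- One step of a sweep to the left. -/
def backStep (T : CompTapes M N k) : CompTapes M N k := act T (backAct (reads T))

/-- One step of a sweep to the right. -/
def forthStep (p : Stage) (b : Bool) (T : CompTapes M N k) : CompTapes M N k :=
  act T (forthAct p b (reads T))

theorem backStep_clk (n : ℕ) (T : CompTapes M N k) :
    (backStep^[n] T) clk = { cells := (T clk).cells, head := (T clk).head - n } := by
  rw [iterate_tape (f := fun t => t.writeMove t.read Move.left) (fun T => rfl), Tape.left_iterate]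

theorem backStep_scratch {i : CompTape M N k} (hi : isScratch i = true) (n : ℕ)
    (T : CompTapes M N k) :
    (backStep^[n] T) i = { cells := (T i).cells, head := (T i).head - n } := by
  rw [iterate_tape (f := fun t => t.writeMove t.read Move.left), Tape.left_iterate]
  intro T
  rcases i with _ | _ | _ | _ | (_ | _ | _ | _ | _ | _ | _ | _ | _) <;>
    simp_all [backStep, act, backAct, isScratch]

theorem backStep_other {i : CompTape M N k} (hi : isScratch i = false) (hc : i ≠ clk) (n : ℕ)
    (T : CompTapes M N k) : (backStep^[n] T) i = T i := by
  rw [iterate_tape (f := id), Function.iterate_id, id]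
  intro T
  rcases i with _ | _ | _ | _ | (_ | _ | _ | _ | _ | _ | _ | _ | _) <;>
    simp_all [backStep, act, backAct, isScratch, Tape.writeMove_read_stay]

theorem forthStep_clk (p : Stage) (b : Bool) (n : ℕ) (T : CompTapes M N k) :
    ((forthStep p b)^[n] T) clk = { cells := (T clk).cells, head := (T clk).head + n } := by
  rw [iterate_tape (f := fun t => t.writeMove t.read Move.right) (fun T => rfl),
    Tape.right_iterate]

theorem forthStep_erase {p : Stage} {i : CompTape M N k} (hi : isScratch i = true)
    (hk : keeps p i = false) (n : ℕ) (T : CompTapes M N k) (hT : (T i).head = 0) :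
    ((forthStep p false)^[n] T) i =
      { cells := fun j => if j < n then none else (T i).cells j, head := n } := by
  rw [iterate_tape (f := fun t => t.writeMove none Move.right), Tape.erase_iterate _ hT]
  intro T
  have : i ≠ clk := by rintro rfl; simp [isScratch] at hi
  simp only [forthStep, act]
  rw [forthAct]
  · simp [hi, hk]
  · exact this

theorem forthStep_other {p : Stage} {b : Bool} {i : CompTape M N k} (hc : i ≠ clk)
    (hi : ¬ (b = false ∧ isScratch i = true ∧ keeps p i = false)) (n : ℕ) (T : CompTapes M N k) :
    ((forthStep p b)^[n] T) i = T i := by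
  rw [iterate_tape (f := id), Function.iterate_id, id]
  intro T
  simp only [forthStep, act]
  rw [forthAct]
  · simp [hi, Tape.writeMove_read_stay]
  · exact hc

theorem exec_back (p : Stage) (b : Bool) {T : CompTapes M N k} {L h : ℕ}
    (hT : T clk = tally L h) :
    (composite M N k x₀).Exec φ (conf (.back p b) T) (List.replicate (h + 1) none)
      (conf (.forth p b) (backStep^[h] T)) := by
  have hclk : ∀ m, (backStep^[m] T) clk = tally L (h - m) := fun m => by
    rw [backStep_clk, hT]; rfl
  rw [List.replicate_succ']
  refine (exec_loop (a := backAct) (by simp) T h fun m hm => ?_).append ?_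
  · have := hclk m
    rw [compTrans, if_neg]
    change ¬ ((backStep^[m] T) clk).read = _
    rw [this, tally_read_eq_mark]
    omega
  · have h1 := exec_step (x₀ := x₀) (φ := φ) (T := backStep^[h] T) (q := .back p b)
      (q' := .forth p b) (a := idle (reads (backStep^[h] T))) (by
        rw [compTrans, if_pos]
        simp only [reads]
        rw [hclk, tally_read_eq_mark]
        omega) (by simp)
    rwa [act_idle] at h1

theorem exec_forth (p : Stage) (b : Bool) {T : CompTapes M N k} {L : ℕ}
    (hT : T clk = tally L 0) :
    (composite M N k x₀).Exec φ (conf (.forth p b) T) (List.replicate (L + 2) none)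
      (conf (if b then afterReset p else .back p true) ((forthStep p b)^[L + 1] T)) := by
  have hclk : ∀ m, ((forthStep p b)^[m] T) clk = tally L m := fun m => by
    rw [forthStep_clk, hT]; simp [tally]
  rw [List.replicate_succ']
  refine (exec_loop (a := forthAct p b) (by simp) T (L + 1) fun m hm => ?_).append ?_
  · have := hclk m
    rw [compTrans, if_neg]
    change ¬ (((forthStep p b)^[m] T) clk).read = _
    rw [this, tally_read_eq_none]
    omega
  · have h1 := exec_step (x₀ := x₀) (φ := φ) (T := (forthStep p b)^[L + 1] T) (q := .forth p b)
      (q' := if b then afterReset p else .back p true)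
      (a := idle (reads ((forthStep p b)^[L + 1] T))) (by
        rw [compTrans, if_pos]
        simp only [reads]
        rw [hclk, tally_read_eq_none]
        omega) (by cases b <;> cases p <;> simp [afterReset])
    rwa [act_idle] at h1

/-- The clock is at its right end, and its length bounds heads and contents of the scratch
tapes. -/
def Clocked (T : CompTapes M N k) (L : ℕ) : Prop :=
  T clk = tally L (L + 1) ∧ ∀ i, isScratch i = true → (T i).BoundedBy (L + 1)

/-- A reset consists of four sweeps: to the left, to the right (erasing), to the left and to the
right. -/
theorem exec_reset (p : Stage) {T : CompTapes M N k} {L h : ℕ}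
    (hT : T clk = tally L h) (hh : h ≤ L + 1)
    (hb : ∀ i, isScratch i = true → (T i).BoundedBy h) :
    ∃ n T', (composite M N k x₀).Exec φ (conf (.back p false) T) (List.replicate n none)
        (conf (afterReset p) T') ∧ n ≤ 4 * L + 8 ∧ Clocked T' L ∧
      (∀ i, isMain i = true → T' i = T i) ∧
      (∀ i, isScratch i = true → keeps p i = true → T' i = (T i).rewind) ∧
      (∀ i, isScratch i = true → keeps p i = false → T' i = Tape.ofWord []) := by
  set T₁ := backStep^[h] T with hT₁
  set T₂ := (forthStep p false)^[L + 1] T₁ with hT₂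
  set T₃ := backStep^[L + 1] T₂ with hT₃
  set T₄ := (forthStep p true)^[L + 1] T₃ with hT₄
  have hc₁ : T₁ clk = tally L 0 := by rw [hT₁, backStep_clk, hT]; simp [tally]
  have hc₂ : T₂ clk = tally L (L + 1) := by rw [hT₂, forthStep_clk, hc₁]; simp [tally]
  have hc₃ : T₃ clk = tally L 0 := by rw [hT₃, backStep_clk, hc₂]; simp [tally]
  have hc₄ : T₄ clk = tally L (L + 1) := by rw [hT₄, forthStep_clk, hc₃]; simp [tally]
  have hne : ∀ i : CompTape M N k, isScratch i = true → i ≠ clk := by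
    rintro i hi rfl; simp [isScratch] at hi
  have hs₁ : ∀ i, isScratch i = true → T₁ i = (T i).rewind := fun i hi => by
    have := (hb i hi).1
    rw [hT₁, backStep_scratch hi, Nat.sub_eq_zero_of_le this]; rfl
  have hkeep : ∀ i, isScratch i = true → keeps p i = true → T₄ i = (T i).rewind :=
    fun i hi hk => by
      rw [hT₄, forthStep_other (hne i hi) (by simp), hT₃, backStep_scratch hi, hT₂,
        forthStep_other (hne i hi) (by simp [hk]), hs₁ i hi]
      simp [Tape.rewind]
  have herase : ∀ i, isScratch i = true → keeps p i = false → T₄ i = Tape.ofWord [] :=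
    fun i hi hk => by
      rw [hT₄, forthStep_other (hne i hi) (by simp), hT₃, backStep_scratch hi, hT₂,
        forthStep_erase hi hk _ _ (by rw [hs₁ i hi]; rfl), hs₁ i hi]
      apply Tape.ext'
      · funext j
        have := (hb i hi).2 j
        simp only [Tape.rewind, Tape.ofWord]
        split_ifs with hj
        · simp
        · rw [this (by omega)]; simp
      · simp [Tape.ofWord]
  refine ⟨(h + 1) + (L + 2) + (L + 1 + 1) + (L + 2), T₄, ?_, by omega, ⟨hc₄, fun i hi => ?_⟩,
    fun i hi => ?_, hkeep, herase⟩
  · rw [List.replicate_add, List.replicate_add, List.replicate_add]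
    exact (((exec_back p false hT).append (exec_forth p false hc₁)).append
      (exec_back p true hc₂)).append (exec_forth p true hc₃)
  · cases hk : keeps p i with
    | false => rw [herase i hi hk]; exact Tape.BoundedBy.ofWord_nil _
    | true => rw [hkeep i hi hk]; exact ((hb i hi).mono hh).rewind
  · have hi' : isScratch i = false ∧ i ≠ clk := by
      rcases i with _ | _ | _ | _ | (_ | _ | _ | _ | _ | _ | _ | _ | _) <;>
        simp_all [isScratch, isMain]
    rw [hT₄, forthStep_other hi'.2 (by simp), hT₃, backStep_other hi'.1 hi'.2, hT₂,
      forthStep_other hi'.2 (by simp [hi'.1]), hT₁, backStep_other hi'.1 hi'.2]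

end Composite

/-! ### Invariants of the simulation -/

section Composite

variable {A : Type u} {M N : OracleMachine A} {k : ℕ} {x₀ : A} {φ : Baire A}

/-- The tapes that matter to the outer machine only are unchanged, and the contents of its query
tape are. -/
def Frame (T T' : CompTapes M N k) : Prop :=
  (∀ i, isMain i = true → T' i = T i) ∧ (T' oq).cells = (T oq).cells

theorem Frame.trans {T T' T'' : CompTapes M N k} (h : Frame T T') (h' : Frame T' T'') :
    Frame T T'' :=
  ⟨fun i hi => (h'.1 i hi).trans (h.1 i hi), h'.2.trans h.2⟩

theorem Clocked.act {T : CompTapes M N k} {L : ℕ} (h : Clocked T L) {a : CompAct M N k}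
    (ha : a clk = (mark false, .right)) : Clocked (act T a) (L + 1) := by
  refine ⟨?_, fun i hi => (h.2 i hi).writeMove _ _⟩
  rw [TypeTwo.act, ha, h.1, tally_writeMove_right]

theorem Clocked.reads_clk {T : CompTapes M N k} {L : ℕ} (h : Clocked T L) :
    reads T clk = none := by
  rw [reads, h.1, tally_read_eq_none]
  omega

/-! ### Copying -/

/-- A query of the outer machine is copied to the input tape of the inner machine, and its length is
put on the digit tapes, with all heads at the right end. -/
theorem exec_copyIn {T : CompTapes M N k} {L : ℕ} (hT : Clocked T L) (hq : (T oq).head = 0)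
    (hi : T (.work .innerInput) = Tape.ofWord [])
    (hd : ∀ j, T (.work (.digit j)) = Tape.ofWord []) :
    ∃ T', (composite M N k x₀).Exec φ (conf .prep T)
        (List.replicate ((T oq).word.length + 2) none) (conf (.count fun _ => false) T') ∧
      Clocked T' (L + (T oq).word.length + 2) ∧ Frame T T' ∧
      T' (.work .innerInput) = Tape.typed (T oq).word ∧
      (∀ j, T' (.work (.digit j)) = tally (T oq).word.length ((T oq).word.length + 1)) ∧
      T' .query = T .query := by
  set b := (T oq).word with hb
  have hblank : ∀ i, L + 1 ≤ i → (T oq).cells i = none := (hT.2 oq rfl).2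
  have key : ∀ m ≤ b.length, ∃ T', (composite M N k x₀).Exec φ (conf .prep T)
        (List.replicate (m + 1) none) (conf .copyIn T') ∧
      Clocked T' (L + m + 1) ∧ Frame T T' ∧ (T' oq).head = m ∧
      T' (.work .innerInput) = Tape.typed (b.take m) ∧
      (∀ j, T' (.work (.digit j)) = tally m (m + 1)) ∧
      T' .query = T .query := by
    intro m
    induction m with
    | zero =>
      intro _
      have hidle : ∀ i, prepAct (reads T) i = ((T i).read, Move.stay) →
          act T (prepAct (reads T)) i = T i := fun i h => by
        rw [act, h]; exact Tape.writeMove_read_stay _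
      refine ⟨act T (prepAct (reads T)), exec_step rfl (by simp), hT.act rfl,
        ⟨fun i hi => hidle i ?_, ?_⟩, ?_, ?_, fun j => ?_, hidle _ rfl⟩
      · rcases i with _ | _ | _ | _ | (_ | _ | _ | _ | _ | _ | _ | _ | _) <;>
          simp_all [isMain, prepAct]
      · rw [hidle _ rfl]
      · rw [hidle _ rfl, hq]
      · rw [hidle _ rfl, hi]; rfl
      · simp only [act, hd]; exact ofWord_nil_writeMove_mark
    | succ m ih =>
      intro hm
      obtain ⟨T', he, hc, hf, hh, hin, hdig, hqu⟩ := ih (by omega)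
      have hread : reads T' oq = some (.inl b[m]) := by
        rw [reads, Tape.read, hf.2, hh]
        exact Tape.cells_of_lt_word hblank hm
      have hidle : ∀ i, copyInAct b[m] (reads T') i = ((T' i).read, Move.stay) →
          act T' (copyInAct b[m] (reads T')) i = T' i := fun i h => by
        rw [act, h]; exact Tape.writeMove_read_stay _
      refine ⟨act T' (copyInAct b[m] (reads T')), ?_, hc.act rfl,
        hf.trans ⟨fun i hi => hidle i ?_, ?_⟩, ?_, ?_, fun j => ?_, ?_⟩
      · rw [List.replicate_succ']
        exact he.append (exec_step (by rw [compTrans, hread]; rfl) (by simp))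
      · rcases i with _ | _ | _ | _ | (_ | _ | _ | _ | _ | _ | _ | _ | _) <;>
          simp_all [isMain, copyInAct]
      · exact Tape.cells_writeMove_read _ _
      · simp [act, copyInAct, Tape.writeMove, hh]
      · rw [act, hin, copyInAct, Tape.typed_writeMove, List.take_append_getElem]
      · rw [act, hdig, copyInAct, tally_writeMove_right]
      · rw [hidle _ rfl, hqu]
  obtain ⟨T', he, hc, hf, hh, hin, hdig, hqu⟩ := key b.length le_rfl
  have hread : (reads T' oq).letter? = none := by
    rw [reads, Tape.read, hf.2, hh, Tape.word_spec hblank _ le_rfl]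
    simp
  have hidle : ∀ i, i ≠ clk → act T' (tickAct .right (reads T')) i = T' i := fun i h => by
    rw [act, tickAct]
    · exact Tape.writeMove_read_stay _
    · exact h
  refine ⟨act T' (tickAct .right (reads T')), ?_, hc.act rfl,
    hf.trans ⟨fun i hi => hidle i ?_, ?_⟩, ?_, fun j => ?_, ?_⟩
  · rw [List.replicate_succ']
    exact he.append (exec_step (by rw [compTrans, hread]) (by simp))
  · rintro rfl; simp [isMain] at hi
  · rw [hidle _ (by simp)]
  · rw [hidle _ (by simp), hin, List.take_length]
  · rw [hidle _ (by simp), hdig]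
  · rw [hidle _ (by simp), hqu]

theorem exec_copyOut {T : CompTapes M N k} {L : ℕ} (hT : Clocked T L)
    (hh : (T (.work .innerOutput)).head = 0)
    (ha : T (.work .outerAnswer) = Tape.ofWord []) :
    ∃ T', (composite M N k x₀).Exec φ (conf .copyOut T)
        (List.replicate ((T (.work .innerOutput)).word.length + 1) none)
        (conf (.back .ret false) T') ∧
      Clocked T' (L + (T (.work .innerOutput)).word.length) ∧ Frame T T' ∧
      T' (.work .outerAnswer) = Tape.typed (T (.work .innerOutput)).word := by
  set b := (T (.work .innerOutput)).word with hb
  have hblank : ∀ i, L + 1 ≤ i → (T (.work .innerOutput)).cells i = none :=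
    (hT.2 (.work .innerOutput) rfl).2
  have key : ∀ m ≤ b.length, ∃ T', (composite M N k x₀).Exec φ (conf .copyOut T)
        (List.replicate m none) (conf .copyOut T') ∧
      Clocked T' (L + m) ∧ Frame T T' ∧
      (T' (.work .innerOutput)).cells = (T (.work .innerOutput)).cells ∧
      (T' (.work .innerOutput)).head = m ∧
      T' (.work .outerAnswer) = Tape.typed (b.take m) := by
    intro m
    induction m with
    | zero =>
      exact fun _ => ⟨T, .nil _, hT, ⟨fun _ _ => rfl, rfl⟩, rfl, hh, ha⟩
    | succ m ih =>
      intro hm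
      obtain ⟨T', he, hc, hf, hcell, hh, han⟩ := ih (by omega)
      have hread : reads T' (.work .innerOutput) = some (.inl b[m]) := by
        rw [reads, Tape.read, hcell, hh]
        exact Tape.cells_of_lt_word hblank hm
      have hidle : ∀ i, copyOutAct b[m] (reads T') i = ((T' i).read, Move.stay) →
          act T' (copyOutAct b[m] (reads T')) i = T' i := fun i h => by
        rw [act, h]; exact Tape.writeMove_read_stay _
      refine ⟨act T' (copyOutAct b[m] (reads T')), ?_, hc.act rfl,
        hf.trans ⟨fun i hi => hidle i ?_, ?_⟩, ?_, ?_, ?_⟩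
      · rw [List.replicate_succ']
        exact he.append (exec_step (by rw [compTrans, hread]; rfl) (by simp))
      · rcases i with _ | _ | _ | _ | (_ | _ | _ | _ | _ | _ | _ | _ | _) <;>
          simp_all [isMain, copyOutAct]
      · rw [hidle _ rfl]
      · rw [← hcell]; exact Tape.cells_writeMove_read _ _
      · simp [act, copyOutAct, Tape.writeMove, hh]
      · rw [act, han, copyOutAct, Tape.typed_writeMove, List.take_append_getElem]
  obtain ⟨T', he, hc, hf, hcell, hh, han⟩ := key b.length le_rfl
  have hread : (reads T' (.work .innerOutput)).letter? = none := by
    rw [reads, Tape.read, hcell, hh, Tape.word_spec hblank _ le_rfl]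
    simp
  refine ⟨T', ?_, hc, hf, by rw [han, List.take_length]⟩
  rw [List.replicate_succ']
  have h1 := exec_step (x₀ := x₀) (φ := φ) (T := T') (q := .copyOut) (q' := .back .ret false)
    (a := idle (reads T')) (by rw [compTrans, hread]) (by simp)
  rw [act_idle] at h1
  exact he.append h1

/-! ### The inflated query -/

/-- The number of cells that the head in position `h` of a digit tape has still to traverse. -/
def remaining (n : ℕ) (d : Bool) (h : ℕ) : ℕ := if d then n + 1 - h else h

/-- The number of steps that the odometer has still to do. -/
def odometer (n : ℕ) (dir : Fin k → Bool) (h : Fin k → ℕ) : ℕ :=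
  ∑ j, remaining n (dir j) (h j) * (n + 2) ^ (j : ℕ)

/-- The value of a number with `k` digits in base `c + 1` decreases by one if a digit is decreased
by one and all lower digits, which were zero, become `c`. -/
theorem sum_digits_succ (c k : ℕ) (j : Fin k) (old new : Fin k → ℕ)
    (hlt : ∀ i < j, old i = 0 ∧ new i = c) (heq : old j = new j + 1)
    (hgt : ∀ i, j < i → old i = new i) :
    ∑ i, old i * (c + 1) ^ (i : ℕ) = ∑ i, new i * (c + 1) ^ (i : ℕ) + 1 := by
  induction k with
  | zero => exact j.elim0
  | succ k ih =>
    rw [Fin.sum_univ_castSucc, Fin.sum_univ_castSucc]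
    rcases Fin.eq_castSucc_or_eq_last j with ⟨j', rfl⟩ | rfl
    · have h1 := ih j' (fun i => old i.castSucc) (fun i => new i.castSucc)
        (fun i hi => hlt _ (Fin.castSucc_lt_castSucc_iff.2 hi)) heq
        (fun i hi => hgt _ (Fin.castSucc_lt_castSucc_iff.2 hi))
      have h2 := hgt (Fin.last k) (Fin.castSucc_lt_last j')
      simp only [Fin.val_castSucc, Fin.val_last] at h1 ⊢
      rw [h1, h2]
      ring
    · have h1 : ∑ i : Fin k, old i.castSucc * (c + 1) ^ (i.castSucc : ℕ) = 0 :=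
        Finset.sum_eq_zero fun i _ => by rw [(hlt _ (Fin.castSucc_lt_last i)).1, Nat.zero_mul]
      have h2 : ∑ i : Fin k, new i.castSucc * (c + 1) ^ (i.castSucc : ℕ) + 1 = (c + 1) ^ k := by
        have h3 : ∀ n, ∑ i ∈ Finset.range n, c * (c + 1) ^ i + 1 = (c + 1) ^ n := by
          intro n
          induction n with
          | zero => simp
          | succ n ih => rw [Finset.sum_range_succ, pow_succ]; linarith
        rw [← h3 k, Finset.sum_range]
        congr 1
        exact Finset.sum_congr rfl fun i _ => by
          rw [(hlt _ (Fin.castSucc_lt_last i)).2, Fin.val_castSucc]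
      rw [h1, heq, Fin.val_last, add_mul, one_mul, ← h2]
      ring

theorem odometer_start (n k : ℕ) :
    odometer n (fun _ : Fin k => false) (fun _ => n + 1) + 1 = (n + 2) ^ k := by
  have h3 : ∀ m, ∑ i ∈ Finset.range m, (n + 1) * (n + 2) ^ i + 1 = (n + 2) ^ m := by
    intro m
    induction m with
    | zero => simp
    | succ m ih => rw [Finset.sum_range_succ, pow_succ]; linarith
  rw [← h3 k, Finset.sum_range]
  rfl

theorem atEnd_iff {T : CompTapes M N k} {n : ℕ} {h : Fin k → ℕ} {dir : Fin k → Bool} {j : Fin k}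
    (hd : T (.work (.digit j)) = tally n (h j)) (hh : h j ≤ n + 1) :
    AtEnd dir (reads T) j ↔ remaining n (dir j) (h j) = 0 := by
  rw [AtEnd, reads, hd, tally_read_eq_mark, tally_read_eq_none, remaining]
  split_ifs
  · omega
  · rfl

theorem exists_least_not_atEnd {dir : Fin k → Bool} {rd : CompTape M N k → CompCell M N}
    {j : Fin k} (hj : ¬ AtEnd dir rd j) :
    ∃ j, ¬ AtEnd dir rd j ∧ ∀ i < j, AtEnd dir rd i := by
  obtain ⟨m, hm, hmin⟩ := WellFounded.has_min (wellFounded_lt (α := Fin k))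
    {j | ¬ AtEnd dir rd j} ⟨j, hj⟩
  exact ⟨m, hm, fun i hi => by_contra fun h => hmin i h hi⟩

/-- The odometer runs for exactly as many steps as its value says, each of which adds a letter to
the inflated query. -/
theorem exec_count (n : ℕ) (m : ℕ) {T : CompTapes M N k} {L c : ℕ} {dir : Fin k → Bool}
    {h : Fin k → ℕ} (hT : Clocked T L) (hh : ∀ j, h j ≤ n + 1)
    (hd : ∀ j, T (.work (.digit j)) = tally n (h j))
    (hq : T .query = Tape.typed (List.replicate c x₀)) (hm : odometer n dir h = m) :
    ∃ dir' T', (composite M N k x₀).Exec φ (conf (.count dir) T) (List.replicate m none)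
        (conf (.count dir') T') ∧
      Clocked T' (L + m) ∧ Frame T T' ∧ T' (.work .innerInput) = T (.work .innerInput) ∧
      T' .query = Tape.typed (List.replicate (c + m) x₀) ∧ ∀ j, AtEnd dir' (reads T') j := by
  classical
  induction m generalizing T L c dir h with
  | zero =>
    refine ⟨dir, T, .nil _, hT, ⟨fun _ _ => rfl, rfl⟩, rfl, hq, fun j => ?_⟩
    rw [atEnd_iff (hd j) (hh j)]
    have := Finset.sum_eq_zero_iff.1 hm j (Finset.mem_univ _)
    simpa using this
  | succ m ih =>
    have hex : ∃ j, ¬ AtEnd dir (reads T) j ∧ ∀ i < j, AtEnd dir (reads T) i := by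
      by_contra hno
      have hall : ∀ j, AtEnd dir (reads T) j := fun j =>
        by_contra fun hj => hno (exists_least_not_atEnd hj)
      have : odometer n dir h = 0 := Finset.sum_eq_zero fun j _ => by
        rw [(atEnd_iff (hd j) (hh j)).1 (hall j), Nat.zero_mul]
      omega
    obtain ⟨hj₁, hj₂⟩ := hex.choose_spec
    have htr : compTrans x₀ (.count dir) (reads T) =
        some (.count fun i => if i < hex.choose then !dir i else dir i,
          countAct x₀ hex.choose (dir hex.choose) (reads T)) := by
      rw [compTrans, dif_pos hex]
    generalize hex.choose = j at hj₁ hj₂ htr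
    rw [atEnd_iff (hd j) (hh j)] at hj₁
    have hj₂ : ∀ i < j, remaining n (dir i) (h i) = 0 := fun i hi =>
      (atEnd_iff (hd i) (hh i)).1 (hj₂ i hi)
    -- the head positions after the step
    let h' : Fin k → ℕ := fun i => if i = j then (if dir j then h j + 1 else h j - 1) else h i
    have hidle : ∀ i, countAct x₀ j (dir j) (reads T) i = ((T i).read, Move.stay) →
        act T (countAct x₀ j (dir j) (reads T)) i = T i := fun i h => by
      rw [act, h]; exact Tape.writeMove_read_stay _
    have hjd := hh j
    obtain ⟨dir', T', he, hc, hf, hin, hq', hend⟩ := ih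
      (T := act T (countAct x₀ j (dir j) (reads T))) (L := L + 1) (c := c + 1)
      (dir := fun i => if i < j then !dir i else dir i) (h := h') (hT.act rfl) (fun i => by
        simp only [h', remaining] at hj₁ ⊢
        have := hh i
        split_ifs at hj₁ ⊢ <;> omega) (fun i => by
        apply Tape.ext'
        · rw [show (tally n (h' i) : Tape A (CompAux M.Aux N.Aux)).cells =
            (tally n (h i) : Tape A (CompAux M.Aux N.Aux)).cells from rfl, ← hd i]
          exact Tape.cells_writeMove_read _ _
        · simp only [act, countAct, Tape.writeMove, hd, h', tally]
          by_cases hij : i = j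
          · subst hij
            cases dir i <;> simp
          · simp [hij]) (by
        rw [act, hq, countAct, Tape.typed_writeMove, ← List.replicate_succ']) (by
        have := sum_digits_succ (n + 1) k j (fun i => remaining n (dir i) (h i))
          (fun i => remaining n (if i < j then !dir i else dir i) (h' i)) (fun i hi => by
            refine ⟨hj₂ i hi, ?_⟩
            have h1 := hj₂ i hi
            have h2 := hh i
            simp only [h', if_neg hi.ne, if_pos hi]
            cases hdi : dir i <;> simp [remaining, hdi] at h1 ⊢ <;> omega)
          (by
            simp only [h', lt_irrefl, if_true, if_false]
            cases hdi : dir j <;> simp [remaining, hdi] at hj₁ ⊢ <;> omega)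
          (fun i hi => by simp [h', hi.ne', hi.not_gt])
        simp only [odometer] at hm ⊢
        exact Nat.succ_injective (this.symm.trans hm))
    refine ⟨dir', T', ?_, ?_, Frame.trans ⟨fun i hi => hidle i ?_, ?_⟩ hf, ?_, ?_, hend⟩
    · rw [List.replicate_succ]
      exact (exec_step htr (by simp)).append he
    · rwa [show L + (m + 1) = L + 1 + m by omega]
    · rcases i with _ | _ | _ | _ | (_ | _ | _ | _ | _ | _ | _ | _ | _) <;>
          simp_all [isMain, countAct]
    · rw [hidle _ rfl]
    · rw [hin, hidle _ rfl]
    · rwa [show c + (m + 1) = c + 1 + m by omega]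

/-- The inflated query is posed as soon as the odometer has stopped. -/
theorem exec_ask {T : CompTapes M N k} {L c : ℕ} {dir : Fin k → Bool} (hT : Clocked T L)
    (hq : T .query = Tape.typed (List.replicate c x₀)) (hend : ∀ j, AtEnd dir (reads T) j) :
    ∃ T', (composite M N k x₀).Exec φ (conf (.count dir) T)
        [some (List.replicate c x₀), none] (conf (.back .ask false) T') ∧
      T' clk = tally (L + 1) (L + 1) ∧ (∀ i, isScratch i = true → (T' i).BoundedBy (L + 1)) ∧
      Frame T T' ∧ T' (.work .innerInput) = T (.work .innerInput) := by
  have hidle : ∀ i, i ≠ clk → act T (tickAct .stay (reads T)) i = T i := fun i h => by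
    rw [act, tickAct]
    · exact Tape.writeMove_read_stay _
    · exact h
  have htr : compTrans x₀ (.count dir) (reads T) =
      some (.inner N.oracleState true, tickAct .stay (reads T)) := by
    rw [compTrans, dif_neg]
    rintro ⟨j, hj, -⟩
    exact hj (hend j)
  have h1 := OracleMachine.exec_of_advance_oracle (φ := φ) (advance_conf htr) rfl
  set T₁ := ((composite M N k x₀).answer φ
    (conf (.inner N.oracleState true) (act T (tickAct .stay (reads T))))).tape with hT₁
  have hT₁i : ∀ i, i ≠ .query → i ≠ .answer → i ≠ clk → T₁ i = T i := fun i h h' h'' => by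
    rw [hT₁, ← hidle i h'']
    cases i <;> first | rfl | contradiction
  have hT₁q : T₁ .query = (T .query).rewind := by rw [← hidle .query (by simp)]; rfl
  have hclk : T₁ clk = tally (L + 1) (L + 1) := by
    change act T (tickAct .stay (reads T)) clk = _
    rw [act, hT.1]
    exact tally_writeMove_stay L
  have h2 := exec_step (x₀ := x₀) (φ := φ) (T := T₁) (q := .inner N.oracleState true)
    (q' := .back .ask false) (a := idle (reads T₁)) (by
      rw [compTrans, if_neg]
      rw [reads, hclk, tally_read_eq_none]
      omega) (by simp)
  rw [act_idle] at h2
  refine ⟨T₁, ?_, hclk, fun i hi => ?_, ⟨fun i hi => hT₁i i ?_ ?_ ?_, ?_⟩, ?_⟩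
  · have h3 := h1.append h2
    have h4 : ((conf (x₀ := x₀) (.inner N.oracleState true)
        (act T (tickAct .stay (reads T)))).tape .query).word = List.replicate c x₀ := by
      change (act T (tickAct .stay (reads T)) .query).word = _
      rw [hidle _ (by simp), hq, Tape.word_typed]
    rw [h4] at h3
    exact h3
  · by_cases hiq : i = .query
    · rw [hiq, hT₁q]; exact (hT.2 .query rfl).rewind
    · rw [hT₁i i hiq (by rintro rfl; simp [isScratch] at hi)
        (by rintro rfl; simp [isScratch] at hi)]
      exact hT.2 i hi
  · rintro rfl; simp [isMain] at hi
  · rintro rfl; simp [isMain] at hi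
  · rintro rfl; simp [isMain] at hi
  · rw [hT₁i _ (by simp) (by simp) (by simp)]
  · rw [hT₁i _ (by simp) (by simp) (by simp)]

end Composite

section Composite

variable {A : Type u} {M N : OracleMachine A} {k : ℕ} {x₀ : A} {φ ψ : Baire A}

/-! ### Simulation of the inner machine -/

/-- The tapes of the composite machine hold those of a configuration of the inner machine. -/
def InnerRel (c : N.Config) (asked : Bool) (T : CompTapes M N k) : Prop :=
  ∀ i, T (innerName asked i) = (c.tape i).map (Sum.inr ∘ Sum.inl)

/-- The tapes of the composite machine hold those of a configuration of the outer machine. -/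
def OuterRel (c : M.Config) (T : CompTapes M N k) : Prop :=
  ∀ i, T (outerName i) = (c.tape i).map Sum.inl

theorem InnerRel.reads {c : N.Config} {asked : Bool} {T : CompTapes M N k}
    (h : InnerRel c asked T) (i : TapeName N.Work) :
    Function.invFun innerCell (reads T (innerName asked i)) = (c.tape i).read := by
  rw [TypeTwo.reads, h, Tape.read_map]
  exact Function.leftInverse_invFun
    (Cell.map_injective (Sum.inr_injective.comp Sum.inl_injective)) _

theorem OuterRel.reads {c : M.Config} {T : CompTapes M N k} (h : OuterRel c T)
    (i : TapeName M.Work) :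
    Function.invFun outerCell (reads T (outerName i)) = (c.tape i).read := by
  rw [TypeTwo.reads, h, Tape.read_map]
  exact Function.leftInverse_invFun (Cell.map_injective Sum.inl_injective) _

theorem act_innerAct {c : N.Config} {asked : Bool} {T : CompTapes M N k}
    (h : InnerRel c asked T) (a : TapeName N.Work → Cell A N.Aux × Move) (i : TapeName N.Work) :
    act T (innerAct asked a (reads T)) (innerName asked i) =
      ((c.tape i).writeMove (a i).1 (a i).2).map (Sum.inr ∘ Sum.inl) := by
  rw [Tape.map_writeMove, ← h i]
  cases i <;> cases asked <;> rfl

theorem act_outerAct {c : M.Config} {T : CompTapes M N k}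
    (h : OuterRel c T) (a : TapeName M.Work → Cell A M.Aux × Move) (i : TapeName M.Work) :
    act T (outerAct a (reads T)) (outerName i) =
      ((c.tape i).writeMove (a i).1 (a i).2).map Sum.inl := by
  rw [Tape.map_writeMove, ← h i]
  cases i <;> rfl

theorem frame_innerAct (asked : Bool) (T : CompTapes M N k)
    (a : TapeName N.Work → Cell A N.Aux × Move) :
    Frame T (act T (innerAct asked a (reads T))) := by
  have hidle : ∀ i, innerAct asked a (reads T) i = ((T i).read, Move.stay) →
      act T (innerAct asked a (reads T)) i = T i := fun i h => by
    rw [act, h]; exact Tape.writeMove_read_stay _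
  refine ⟨fun i hi => hidle i ?_, by rw [hidle _ rfl]⟩
  rcases i with _ | _ | _ | _ | (_ | _ | _ | _ | _ | _ | _ | _ | _) <;>
    simp_all [isMain, innerAct]

theorem exec_inner_step {c c' : N.Config} {asked : Bool} {T : CompTapes M N k} {L : ℕ}
    (hc : InnerRel c asked T) (hT : Clocked T L) (hs : N.step φ c = some c') :
    ∃ asked' T', (composite M N k x₀).Exec φ (conf (.inner c.state asked) T) [N.queryOf c]
        (conf (.inner c'.state asked') T') ∧
      InnerRel c' asked' T' ∧ Clocked T' (L + 1) ∧ Frame T T' := by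
  classical
  simp only [OracleMachine.step, Option.map_eq_some_iff] at hs
  obtain ⟨d, hd, rfl⟩ := hs
  have hd' := hd
  simp only [OracleMachine.advance, Option.map_eq_some_iff] at hd'
  obtain ⟨p, hp, rfl⟩ := hd'
  set T₁ := act T (innerAct asked p.2 (reads T)) with hT₁
  have htr : compTrans x₀ (.inner c.state asked) (reads T) =
      some (.inner p.1 (if p.1 = N.oracleState then true else asked),
        innerAct asked p.2 (reads T)) := by
    rw [compTrans, if_pos hT.reads_clk]
    simp only [hc.reads, hp]
  have hcl : Clocked T₁ (L + 1) := hT.act rfl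
  have hfr : Frame T T₁ := frame_innerAct _ _ _
  have hrel := act_innerAct hc p.2
  rw [← hT₁] at hrel
  by_cases ho : p.1 = N.oracleState
  · simp only [OracleMachine.queryOf, hd, Option.bind_some, if_pos ho]
    rw [if_pos ho, ho] at htr
    have h1 := OracleMachine.exec_of_advance_oracle (φ := φ) (advance_conf htr) rfl
    rw [← hT₁] at h1
    have hword : (T₁ .query).word =
        ((c.tape .query).writeMove (p.2 .query).1 (p.2 .query).2).word := by
      rw [← Tape.word_map (Sum.inr ∘ Sum.inl : N.Aux → CompAux M.Aux N.Aux), ← hrel .query]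
      rfl
    refine ⟨true, ((composite M N k x₀).answer φ (conf (.inner N.oracleState true) T₁)).tape,
      ?_, fun i => ?_, ⟨hcl.1, fun i hi => ?_⟩, hfr.trans ⟨fun i hi => ?_, rfl⟩⟩
    · rw [← hword]
      simp only [OracleMachine.answer, ho]
      exact h1
    · cases i with
      | answer =>
        simp only [OracleMachine.answer, innerName, if_true]
        rw [hword, Tape.map_ofWord]
      | query =>
        simp only [OracleMachine.answer, innerName]
        rw [Tape.map_rewind, ← hrel .query]
        rfl
      | input => exact hrel .input
      | output => exact hrel .output
      | work w => exact hrel (.work w)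
    · cases i with
      | answer => simp [isScratch] at hi
      | query => exact (hcl.2 .query rfl).rewind
      | _ => exact hcl.2 _ hi
    · cases i with
      | answer => simp [isMain] at hi
      | query => simp [isMain] at hi
      | _ => rfl
  · simp only [OracleMachine.queryOf, hd, Option.bind_some, if_neg ho]
    rw [if_neg ho] at htr
    exact ⟨asked, T₁, exec_step htr (by simp [ho]), hrel, hcl, hfr⟩

theorem exec_inner {c c' : N.Config} {l : List (Option (List A))} (h : N.Exec φ c l c')
    {asked : Bool} {T : CompTapes M N k} {L : ℕ}
    (hc : InnerRel c asked T) (hT : Clocked T L) :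
    ∃ asked' T', (composite M N k x₀).Exec φ (conf (.inner c.state asked) T) l
        (conf (.inner c'.state asked') T') ∧
      InnerRel c' asked' T' ∧ Clocked T' (L + l.length) ∧ Frame T T' := by
  induction h generalizing asked T L with
  | nil c => exact ⟨asked, T, .nil _, hc, hT, fun _ _ => rfl, rfl⟩
  | @cons c c₁ c₂ l hs _ ih =>
    obtain ⟨a₁, T₁, he₁, hc₁, hT₁, hf₁⟩ := exec_inner_step (x₀ := x₀) hc hT hs
    obtain ⟨a₂, T₂, he₂, hc₂, hT₂, hf₂⟩ := ih hc₁ hT₁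
    refine ⟨a₂, T₂, he₁.append he₂, hc₂, ?_, hf₁.trans hf₂⟩
    rwa [List.length_cons, show L + (l.length + 1) = L + 1 + l.length by omega]

/-! ### Simulation of the outer machine -/

theorem exec_outer_step {c c' : M.Config} {T : CompTapes M N k} {L : ℕ}
    (hc : OuterRel c T) (hT : Clocked T L) (ha : M.advance c = some c')
    (ho : c'.state ≠ M.oracleState) :
    ∃ T', (composite M N k x₀).Exec φ (conf (.outer c.state) T) [none]
        (conf (.outer c'.state) T') ∧ OuterRel c' T' ∧ Clocked T' (L + 1) := by
  simp only [OracleMachine.advance, Option.map_eq_some_iff] at ha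
  obtain ⟨p, hp, rfl⟩ := ha
  refine ⟨act T (outerAct p.2 (reads T)), exec_step ?_ (by simp), act_outerAct hc p.2,
    hT.act rfl⟩
  rw [compTrans]
  simp only [hc.reads, hp, Option.map_some]
  rw [if_neg ho]

/-- The answer to a query of the outer machine: the query is copied, the inflated query is posed,
the inner machine is run, and its output is copied. Up to a constant number of steps, the clock
advances in each step outside the four resets, each of which takes about four times its length. -/
theorem exec_outer_query {c c' : M.Config} {T : CompTapes M N k} {L : ℕ}
    (hc : OuterRel c T) (hT : Clocked T L) (ha : M.advance c = some c')
    (ho : c'.state = M.oracleState) {b : List A} (hb : (c'.tape .query).word = b)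
    {e : N.Config} {l : List (Option (List A))} (he : N.Exec φ (N.init b) l e)
    (hhalt : N.step φ e = none) (hout : (e.tape .output).word = ψ b) :
    ∃ n₁ n₂ n₃ m T' L', (composite M N k x₀).Exec φ (conf (.outer c.state) T)
        (List.replicate n₁ none ++ [some (List.replicate m x₀)] ++
          (List.replicate n₂ none ++ l ++ List.replicate n₃ none))
        (conf (.outer M.oracleState) T') ∧
      OuterRel (M.answer ψ c') T' ∧ Clocked T' L' ∧
      m + 1 = (b.length + 2) ^ k ∧ L' = L + b.length + m + l.length + (ψ b).length + 4 ∧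
      n₁ + 1 + (n₂ + l.length + n₃) ≤ 17 * L' + 40 := by
  simp only [OracleMachine.advance, Option.map_eq_some_iff] at ha
  obtain ⟨p, hp, rfl⟩ := ha
  set m := odometer b.length (fun _ : Fin k => false) (fun _ => b.length + 1) with hm
  have hm' : m + 1 = (b.length + 2) ^ k := odometer_start _ _
  -- the query step of the outer machine
  set T₁ := act T (outerAct p.2 (reads T)) with hT₁
  have hrel : ∀ i, T₁ (outerName i) =
      ((c.tape i).writeMove (p.2 i).1 (p.2 i).2).map Sum.inl := act_outerAct hc p.2
  have hcl₁ : Clocked T₁ (L + 1) := hT.act rfl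
  have e₁ : (composite M N k x₀).Exec φ (conf (.outer c.state) T) [none]
      (conf (.back .call false) T₁) := by
    refine exec_step ?_ (by simp)
    rw [compTrans]
    simp only [hc.reads, hp, Option.map_some]
    rw [if_pos ho]
  -- reset, and copy of the query
  obtain ⟨r₂, T₂, e₂, hr₂, hcl₂, hmain₂, hkeep₂, herase₂⟩ :=
    exec_reset (x₀ := x₀) (φ := φ) .call hcl₁.1 le_rfl hcl₁.2
  have hoq₂ : T₂ oq = (T₁ oq).rewind := hkeep₂ _ rfl rfl
  have hb₂ : (T₂ oq).word = b := by
    rw [hoq₂, Tape.word_rewind, ← hb, ← Tape.word_map (Sum.inl : M.Aux → CompAux M.Aux N.Aux),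
      ← hrel .query]
    rfl
  obtain ⟨T₃, e₃, hcl₃, hf₃, hin₃, hdig₃, hqu₃⟩ := exec_copyIn (x₀ := x₀) (φ := φ) hcl₂
    (by rw [hoq₂]; rfl) (herase₂ _ rfl rfl) fun j => herase₂ _ rfl rfl
  rw [hb₂] at e₃ hcl₃ hin₃ hdig₃
  -- inflated query
  obtain ⟨dir, T₄, e₄, hcl₄, hf₄, hin₄, hqu₄, hend₄⟩ := exec_count (x₀ := x₀) (φ := φ) b.length m
    (c := 0) (h := fun _ => b.length + 1) hcl₃ (fun _ => le_rfl) hdig₃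
    (by rw [hqu₃]; exact herase₂ _ rfl rfl) rfl
  rw [Nat.zero_add] at hqu₄
  obtain ⟨T₅, e₅, hclk₅, hsc₅, hf₅, hin₅⟩ := exec_ask (x₀ := x₀) (φ := φ) hcl₄ hqu₄ hend₄
  -- reset, and run of the inner machine
  obtain ⟨r₆, T₆, e₆, hr₆, hcl₆, hmain₆, hkeep₆, herase₆⟩ :=
    exec_reset (x₀ := x₀) (φ := φ) .ask hclk₅ (Nat.le_succ _) hsc₅
  have hrel₆ : InnerRel (N.init b) false T₆ := by
    have hbl : (Tape.ofWord [] : Tape A N.Aux).map (Sum.inr ∘ Sum.inl) =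
        (Tape.ofWord [] : Tape A (CompAux M.Aux N.Aux)) := Tape.map_ofWord _ _
    intro i
    cases i with
    | input =>
      refine (hkeep₆ (.work .innerInput) rfl rfl).trans ?_
      rw [hin₅, hin₄, hin₃, Tape.rewind_typed]
      exact (Tape.map_ofWord _ _).symm
    | output => exact (herase₆ _ rfl rfl).trans hbl.symm
    | query => exact (herase₆ _ rfl rfl).trans hbl.symm
    | answer => exact (herase₆ (.work .innerAnswer) rfl rfl).trans hbl.symm
    | work w => exact (herase₆ _ rfl rfl).trans hbl.symm
  obtain ⟨asked, T₇, e₇, hrel₇, hcl₇, hf₇⟩ := exec_inner (x₀ := x₀) he hrel₆ hcl₆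
  have e₈ : (composite M N k x₀).Exec φ (conf (.inner e.state asked) T₇) [none]
      (conf (.back .fetch false) T₇) := by
    have hhalt' : N.trans e.state (fun i => (e.tape i).read) = none := by
      rw [OracleMachine.step_eq_none] at hhalt
      simpa [OracleMachine.advance] using hhalt
    have h1 := exec_step (x₀ := x₀) (φ := φ) (T := T₇) (q := .inner e.state asked)
      (q' := .back .fetch false) (a := idle (reads T₇)) (by
        rw [compTrans, if_pos hcl₇.reads_clk]
        simp only [hrel₇.reads, hhalt']) (by simp)
    rwa [act_idle] at h1
  -- reset, and copy of the output
  obtain ⟨r₉, T₉, e₉, hr₉, hcl₉, hmain₉, hkeep₉, herase₉⟩ :=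
    exec_reset (x₀ := x₀) (φ := φ) .fetch hcl₇.1 le_rfl hcl₇.2
  have hout₉ : T₉ (.work .innerOutput) = (T₇ (.work .innerOutput)).rewind := hkeep₉ _ rfl rfl
  have hword₉ : (T₉ (.work .innerOutput)).word = ψ b := by
    rw [hout₉, Tape.word_rewind, ← hout,
      ← Tape.word_map (Sum.inr ∘ Sum.inl : N.Aux → CompAux M.Aux N.Aux), ← hrel₇ .output]
    rfl
  obtain ⟨T₁₀, e₁₀, hcl₁₀, hf₁₀, han₁₀⟩ := exec_copyOut (x₀ := x₀) (φ := φ) hcl₉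
    (by rw [hout₉]; rfl) (herase₉ _ rfl rfl)
  rw [hword₉] at e₁₀ hcl₁₀ han₁₀
  obtain ⟨r₁₁, T₁₁, e₁₁, hr₁₁, hcl₁₁, hmain₁₁, hkeep₁₁, herase₁₁⟩ :=
    exec_reset (x₀ := x₀) (φ := φ) .ret hcl₁₀.1 le_rfl hcl₁₀.2
  -- the contents of the tapes of the outer machine
  have hf₆ : Frame T₅ T₆ := ⟨hmain₆, by rw [hkeep₆ oq rfl rfl]; rfl⟩
  have hf₉ : Frame T₇ T₉ := ⟨hmain₉, by rw [hkeep₉ oq rfl rfl]; rfl⟩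
  have hf₂ : Frame T₁ T₂ := ⟨hmain₂, by rw [hoq₂]; rfl⟩
  have hf : Frame T₁ T₁₀ :=
    ((((((hf₂.trans hf₃).trans hf₄).trans hf₅).trans hf₆).trans hf₇).trans hf₉).trans hf₁₀
  have hmain : ∀ i, isMain i = true → T₁₁ i = T₁ i := fun i hi =>
    (hmain₁₁ i hi).trans (hf.1 i hi)
  have hrel₁₁ : OuterRel (M.answer ψ ⟨p.1, fun i => (c.tape i).writeMove (p.2 i).1 (p.2 i).2⟩)
      T₁₁ := by
    intro i
    cases i with
    | input => exact (hmain .input rfl).trans (hrel .input)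
    | output => exact (hmain .output rfl).trans (hrel .output)
    | work v => exact (hmain (.work (.outer v)) rfl).trans (hrel (.work v))
    | query =>
      refine (hkeep₁₁ oq rfl rfl).trans ?_
      refine Eq.trans ?_ (congrArg Tape.rewind (hrel .query))
      exact Tape.ext' hf.2 rfl
    | answer =>
      refine (hkeep₁₁ (.work .outerAnswer) rfl rfl).trans ?_
      rw [han₁₀, Tape.rewind_typed]
      refine Eq.trans ?_ (Tape.map_ofWord _ _).symm
      simp only at hb
      rw [hb]
  refine ⟨1 + r₂ + (b.length + 2) + m, 1 + r₆, 1 + r₉ + ((ψ b).length + 1) + r₁₁, m, T₁₁, _, ?_,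
    hrel₁₁, hcl₁₁, hm', by omega, ?_⟩
  · have e₁₂ := (((((((((e₁.append e₂).append e₃).append e₄).append e₅).append e₆).append
      e₇).append e₈).append e₉).append e₁₀).append e₁₁
    convert e₁₂ using 1
    · simp only [List.replicate_add, List.replicate_one, List.append_assoc, List.cons_append,
        List.nil_append]
    · rfl
  · omega

/-- The effect of the inflated queries on the values computed by `records`. -/
def inflate (k : ℕ) (s : ℕ × ℕ) : ℕ × ℕ := (if s.1 = 0 then 0 else (s.1 + 1) ^ k, s.2)

open OracleMachine in
theorem recordStep_inflate (hk : k ≠ 0) (s : ℕ × ℕ) {x : ℕ} (hx : x ≠ 0) :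
    recordStep (inflate k s) ((x + 1) ^ k) = inflate k (recordStep s x) := by
  by_cases h : s.1 < x
  · have h1 : (inflate k s).1 < (x + 1) ^ k := by
      simp only [inflate]
      split_ifs with h0
      · positivity
      · exact Nat.pow_lt_pow_left (by omega) hk
    rw [recordStep, if_pos h1, recordStep, if_pos h]
    simp [inflate, hx]
  · have h1 : ¬ (inflate k s).1 < (x + 1) ^ k := by
      simp only [inflate]
      rw [if_neg (by omega), not_lt]
      exact Nat.pow_le_pow_left (by omega) k
    rw [recordStep, if_neg h1, recordStep, if_neg h]

open OracleMachine in
/-- The simulation of a run of the outer machine. Only the inflated queries can be lookahead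
revisions, and they are so exactly if the query of the outer machine is. -/
theorem exec_outer (hk : k ≠ 0) {tr : List A → List (Option (List A))} {fin : List A → N.Config}
    (htr : ∀ b, N.Exec φ (N.init b) (tr b) (fin b)) (hhalt : ∀ b, N.step φ (fin b) = none)
    (hout : ∀ b, ((fin b).tape .output).word = ψ b)
    (hsize : ∀ b, ∀ x ∈ tr b, querySize x ≤ (b.length + 2) ^ k)
    {c c' : M.Config} {l : List (Option (List A))} (h : M.Exec ψ c l c') {W : ℕ}
    (hW : ∀ b, some b ∈ l →
      b.length + (b.length + 2) ^ k + (tr b).length + (ψ b).length + 3 ≤ W)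
    {T : CompTapes M N k} {L : ℕ} (hc : OuterRel c T) (hT : Clocked T L) (s : ℕ × ℕ) :
    ∃ l' T', (composite M N k x₀).Exec φ (conf (.outer c.state) T) l'
        (conf (.outer c'.state) T') ∧ OuterRel c' T' ∧
      l'.length ≤ l.length * (17 * (L + l.length * (W + 1)) + 40) ∧
      (∀ b, some b ∈ l → ∀ x ∈ tr b, x ∈ l') ∧
      records (inflate k s) l' = inflate k (records s l) := by
  classical
  induction h generalizing T L s with
  | nil c => exact ⟨[], T, .nil _, hc, by simp, by simp, rfl⟩
  | @cons c c₁ c₂ l hs _ ih =>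
    have hW' : ∀ b, some b ∈ l →
        b.length + (b.length + 2) ^ k + (tr b).length + (ψ b).length + 3 ≤ W :=
      fun b hb => hW b (List.mem_cons_of_mem _ hb)
    suffices hfirst : ∃ l₁ T₁ L₁, (composite M N k x₀).Exec φ (conf (.outer c.state) T) l₁
        (conf (.outer c₁.state) T₁) ∧ OuterRel c₁ T₁ ∧ Clocked T₁ L₁ ∧ L₁ ≤ L + (W + 1) ∧
        l₁.length ≤ 17 * L₁ + 40 ∧ (∀ b, M.queryOf c = some b → ∀ x ∈ tr b, x ∈ l₁) ∧
        records (inflate k s) l₁ = inflate k (recordStep s (querySize (M.queryOf c))) by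
      obtain ⟨l₁, T₁, L₁, he₁, hc₁, hT₁, hL₁, hl₁, hmem₁, hrec₁⟩ := hfirst
      obtain ⟨l₂, T₂, he₂, hc₂, hl₂, hmem₂, hrec₂⟩ :=
        ih hW' hc₁ hT₁ (recordStep s (querySize (M.queryOf c)))
      refine ⟨l₁ ++ l₂, T₂, he₁.append he₂, hc₂, ?_, fun b hb x hx => ?_, ?_⟩
      · have h1 : L₁ + l.length * (W + 1) ≤ L + (l.length + 1) * (W + 1) := by
          rw [Nat.add_mul]; omega
        have h2 : L₁ ≤ L + (l.length + 1) * (W + 1) := le_trans (Nat.le_add_right _ _) h1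
        rw [List.length_append, List.length_cons, Nat.add_mul]
        have h3 := hl₂.trans (Nat.mul_le_mul_left l.length
          (Nat.add_le_add_right (Nat.mul_le_mul_left 17 h1) 40))
        omega
      · rcases List.mem_cons.1 hb with hb | hb
        · exact List.mem_append_left _ (hmem₁ b hb.symm x hx)
        · exact List.mem_append_right _ (hmem₂ b hb x hx)
      · rw [records_append, hrec₁, hrec₂]
        rfl
    simp only [step, Option.map_eq_some_iff] at hs
    obtain ⟨d, hd, rfl⟩ := hs
    by_cases ho : d.state = M.oracleState
    · have hq : M.queryOf c = some (d.tape .query).word := by simp [queryOf, hd, ho]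
      obtain ⟨n₁, n₂, n₃, m, T₁, L₁, he₁, hc₁, hT₁, hm, hL₁, hlen⟩ :=
        exec_outer_query (x₀ := x₀) (ψ := ψ) hc hT hd ho rfl (htr _) (hhalt _) (hout _)
      rw [if_pos ho, hq]
      have hWb := hW (d.tape .query).word (by rw [hq]; simp)
      refine ⟨_, T₁, L₁, by rw [show (M.answer ψ d).state = M.oracleState from ho]; exact he₁,
        hc₁, hT₁, by omega, by simpa only [List.length_append, List.length_replicate,
          List.length_singleton] using hlen, fun b hb x hx => ?_, ?_⟩
      · obtain rfl := Option.some.inj hb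
        simp [hx]
      · rw [records_append, records_append (inflate k s), records_replicate_none, records_singleton,
          show querySize (some (List.replicate m x₀)) =
            (querySize (some (d.tape .query).word) + 1) ^ k by simp [querySize, hm],
          recordStep_inflate hk _ (by simp [querySize])]
        apply records_of_le
        have hmax : querySize (some (d.tape .query).word) ≤
            (recordStep s (querySize (some (d.tape .query).word))).1 := by
          rw [recordStep]
          split_ifs with h0
          exacts [le_rfl, not_lt.1 h0]
        have hinf : ((d.tape .query).word.length + 2) ^ k ≤
            (inflate k (recordStep s (querySize (some (d.tape .query).word)))).1 := by
          simp only [querySize] at hmax ⊢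
          simp only [inflate]
          rw [if_neg (by omega)]
          exact Nat.pow_le_pow_left (by omega) k
        intro x hx
        simp only [List.mem_append, List.mem_replicate] at hx
        rcases hx with (⟨-, rfl⟩ | hx) | ⟨-, rfl⟩
        · simp [querySize]
        · exact (hsize _ x hx).trans hinf
        · simp [querySize]
    · obtain ⟨T₁, he₁, hc₁, hT₁⟩ := exec_outer_step (x₀ := x₀) (φ := φ) hc hT hd ho
      have hq : M.queryOf c = none := by simp [queryOf, hd, ho]
      rw [if_neg ho, hq]
      exact ⟨[none], T₁, L + 1, he₁, hc₁, hT₁, by omega, by simp, by simp,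
        records_of_le (by simp [querySize])⟩

end Composite

/-! ### Polynomial bounds -/

theorem monotone_eval (p : Polynomial ℕ) : Monotone fun n => p.eval n := by
  intro m n h
  simp only [Polynomial.eval_eq_sum_range]
  gcongr

theorem exists_eval_add_two_le (q : Polynomial ℕ) :
    ∃ k, k ≠ 0 ∧ ∀ n, q.eval n + 2 ≤ (n + 2) ^ k := by
  refine ⟨q.eval 1 + 2 + q.natDegree, by omega, fun n => ?_⟩
  have h1 : q.eval n ≤ q.eval 1 * (n + 2) ^ q.natDegree := by
    simp only [Polynomial.eval_eq_sum_range, one_pow, mul_one, Finset.sum_mul]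
    refine Finset.sum_le_sum fun i hi => Nat.mul_le_mul_left _ ?_
    exact (Nat.pow_le_pow_left (by omega) i).trans
      (Nat.pow_le_pow_right (by omega) (Finset.mem_range_succ_iff.1 hi))
  have h2 : 1 ≤ (n + 2) ^ q.natDegree := Nat.one_le_pow _ _ (by omega)
  have h3 : q.eval 1 + 2 ≤ (n + 2) ^ (q.eval 1 + 2) :=
    Nat.lt_two_pow_self.le.trans (Nat.pow_le_pow_left (by omega) _)
  calc q.eval n + 2 ≤ (q.eval 1 + 2) * (n + 2) ^ q.natDegree := by rw [Nat.add_mul]; omega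
    _ ≤ (n + 2) ^ (q.eval 1 + 2) * (n + 2) ^ q.natDegree := Nat.mul_le_mul_right _ h3
    _ = (n + 2) ^ (q.eval 1 + 2 + q.natDegree) := (pow_add _ _ _).symm

open OracleMachine in
/-- If the size of the oracle's answers to queries of size at most `x` is bounded by `f x`, then a
bound on the size of the queries is obtained by iterating `x ↦ s (f x) + 1` once for each
lookahead revision: until the next one, all answers are bounded in terms of the previous one. -/
theorem OracleMachine.HasStepCount.length_query_le_iterate {A : Type u} {M : OracleMachine A}
    {ψ : Baire A} {s f g : ℕ → ℕ} (hs : M.HasStepCount s) (hmono : Monotone s) {a : List A}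
    {m T r : ℕ} (ha : a.length ≤ m) (hf : ∀ x, x ≤ f x) (hg : ∀ x, x ≤ g x)
    (hsg : ∀ x, s (f x) + 1 ≤ g x) (hT : ∀ t < T, M.step ψ (M.run ψ a t) ≠ none)
    (hψ : ∀ x, m ≤ x → ∀ t < T, ∀ b, M.queryAt ψ a t = some b → b.length ≤ x →
      (ψ b).length ≤ f x)
    (hr : M.LookaheadRevisionLE r) {t : ℕ} (ht : t < T) {b : List A}
    (hb : M.queryAt ψ a t = some b) : b.length ≤ g^[r] m := by
  have hiter : ∀ i x, x ≤ g^[i] x := fun i x => by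
    induction i with
    | zero => exact le_rfl
    | succ i ih => rw [Function.iterate_succ_apply']; exact ih.trans (hg _)
  have hquery : ∀ n, ∀ t < n, ∀ b, M.queryAt ψ a t = some b →
      b.length + 1 ≤ (records (0, 0) ((List.range n).map (M.queryAt ψ a))).1 := by
    intro n t ht b hb
    rw [records_range]
    have := Finset.le_sup (f := fun t => querySize (M.queryAt ψ a t)) (Finset.mem_range.2 ht)
    simpa [hb, querySize] using this
  have key : ∀ n ≤ T, (records (0, 0) ((List.range n).map (M.queryAt ψ a))).1 ≤
      g^[(records (0, 0) ((List.range n).map (M.queryAt ψ a))).2] m + 1 := by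
    intro n
    induction n with
    | zero => intro _; simp [records]
    | succ n ih =>
      intro hn
      have ih := ih (by omega)
      have hq := hquery n
      rw [List.range_succ, List.map_append, records_append, List.map_singleton,
        records_singleton]
      generalize records (0, 0) ((List.range n).map (M.queryAt ψ a)) = R at ih hq ⊢
      rw [recordStep]
      split_ifs with hlt
      · dsimp only
        cases hb : M.queryAt ψ a n with
        | none => simp [querySize]
        | some b =>
          have hnh : ∀ t < n, M.step ψ (M.run ψ a t) ≠ none := fun t ht => hT t (by omega)
          have h1 := length_query_le hnh hb
          have h2 := hs.le_of_not_halted hmono hnh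
          have h3 : M.maxLength ψ a n ≤ f (g^[R.2] m) := by
            refine maxLength_le_iff.2 ⟨ha.trans ((hiter _ _).trans (hf _)), fun t ht b hb => ?_⟩
            exact hψ _ (hiter _ _) t (by omega) b hb (by have := hq t ht b hb; omega)
          have h4 := hmono h3
          have h5 := hsg (g^[R.2] m)
          rw [Function.iterate_succ_apply', querySize]
          omega
      · exact ih
  have h1 := hquery T t ht b hb
  have h2 := key T le_rfl
  have h3 : g^[(records (0, 0) ((List.range T).map (M.queryAt ψ a))).2] m ≤ g^[r] m := by
    obtain ⟨d, hd⟩ := Nat.exists_eq_add_of_le' (records_snd_le hr ψ a T)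
    rw [hd, Function.iterate_add_apply]
    exact hiter _ _
  omega

/-! ### The composite machine computes the composition -/

section Composite

variable {A : Type u} {M N : OracleMachine A} {k : ℕ} {x₀ : A} {φ ψ : Baire A}

/-- The first step puts the left end mark on the clock. -/
theorem exec_boot (a : List A) :
    ∃ T, (composite M N k x₀).Exec φ ((composite M N k x₀).init a) [none]
      (conf (.outer (M.init a).state) T) ∧ OuterRel (M.init a) T ∧ Clocked T 0 := by
  set T₀ : CompTapes M N k := ((composite M N k x₀).init a).tape with hT₀
  have hother : ∀ i, i ≠ clk → act T₀ (bootAct (reads T₀)) i = T₀ i := fun i h => by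
    rw [act, bootAct]
    · exact Tape.writeMove_read_stay _
    · exact h
  have hblank : ∀ i, i ≠ .input → T₀ i = Tape.ofWord [] := fun i h => by
    cases i <;> first | rfl | contradiction
  refine ⟨act T₀ (bootAct (reads T₀)), exec_step (q := .boot) rfl (by simp), fun i => ?_, ?_,
    fun i hi => ?_⟩
  · rw [hother _ (by cases i <;> simp [outerName])]
    cases i <;> exact (Tape.map_ofWord _ _).symm
  · exact ofWord_nil_writeMove_mark
  · rw [hother _ (by rintro rfl; simp [isScratch] at hi),
      hblank _ (by rintro rfl; simp [isScratch] at hi)]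
    exact Tape.BoundedBy.ofWord_nil _

open OracleMachine in
/-- The run of the composite machine, in terms of the runs of the outer and of the inner
machine. -/
theorem exists_haltsIn_composite (hk : k ≠ 0) {τ : List A → ℕ}
    (hτ : ∀ b, N.HaltsIn φ b (τ b))
    (hout : ∀ b, ((N.run φ b (τ b)).tape .output).word = ψ b)
    (hsize : ∀ b, ∀ t < τ b, ∀ b', N.queryAt φ b t = some b' →
      b'.length + 1 ≤ (b.length + 2) ^ k)
    {a : List A} {T r : ℕ} (hT : M.HaltsIn ψ a T) (hr : M.LookaheadRevisionLE r) :
    ∃ T', (composite M N k x₀).HaltsIn φ a T' ∧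
      (((composite M N k x₀).run φ a T').tape .output).word =
        ((M.run ψ a T).tape .output).word ∧
      ((composite M N k x₀).lookaheadRevisions φ a).encard ≤ r ∧
      (∀ t < T, ∀ b, M.queryAt ψ a t = some b → ∀ s < τ b, ∀ b', N.queryAt φ b s = some b' →
        (φ b').length ≤ (composite M N k x₀).maxLength φ a T') ∧
      ∀ W, (∀ t < T, ∀ b, M.queryAt ψ a t = some b →
        b.length + (b.length + 2) ^ k + τ b + (ψ b).length + 3 ≤ W) →
        T' ≤ 1 + T * (17 * (T * (W + 1)) + 40) := by
  obtain ⟨T₁, he₁, hc₁, hcl₁⟩ := exec_boot (M := M) (N := N) (k := k) (x₀ := x₀) (φ := φ) a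
  have hsim := fun (W : ℕ) hW => exec_outer (x₀ := x₀) (ψ := ψ) hk
    (fun b => exec_run b (τ b) (hτ b).2) (fun b => (hτ b).1) hout (fun b x hx => by
      obtain ⟨t, ht, rfl⟩ := List.mem_map.1 hx
      cases hq : N.queryAt φ b t with
      | none => simp [querySize]
      | some b' => exact hsize b t (List.mem_range.1 ht) b' hq)
    (exec_run (φ := ψ) a T hT.2) (W := W) hW hc₁ hcl₁ (0, 0)
  have hhalt : ∀ T₂ : CompTapes M N k, OuterRel (M.run ψ a T) T₂ →
      (composite M N k x₀).step φ (conf (.outer (M.run ψ a T).state) T₂) = none := by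
    intro T₂ hc₂
    have h1 := hT.1
    rw [step_eq_none, advance, Option.map_eq_none_iff] at h1
    rw [step_eq_none, advance, Option.map_eq_none_iff]
    change compTrans x₀ (.outer _) (reads T₂) = none
    rw [compTrans]
    simp only [hc₂.reads, h1, Option.map_none]
  have hfin : ∀ (l' : List (Option (List A))) (T₂ : CompTapes M N k),
      (composite M N k x₀).Exec φ (conf (.outer (M.init a).state) T₁) l'
        (conf (.outer (M.run ψ a T).state) T₂) → OuterRel (M.run ψ a T) T₂ →
      (composite M N k x₀).HaltsIn φ a ([none] ++ l').length ∧
      (composite M N k x₀).run φ a ([none] ++ l').length =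
        conf (.outer (M.run ψ a T).state) T₂ ∧
      [none] ++ l' = (List.range ([none] ++ l').length).map
        ((composite M N k x₀).queryAt φ a) := by
    intro l' T₂ he₂ hc₂
    obtain ⟨h1, h2, h3⟩ := (he₁.append he₂).from_init
    exact ⟨⟨by rw [h1]; exact hhalt _ hc₂, h2⟩, h1, h3⟩
  have hmemW : ∀ (W : ℕ), (∀ t < T, ∀ b, M.queryAt ψ a t = some b →
      b.length + (b.length + 2) ^ k + τ b + (ψ b).length + 3 ≤ W) →
      ∀ b, some b ∈ (List.range T).map (M.queryAt ψ a) → b.length + (b.length + 2) ^ k +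
        ((List.range (τ b)).map (N.queryAt φ b)).length + (ψ b).length + 3 ≤ W := by
    intro W hW b hb
    obtain ⟨t, ht, hq⟩ := List.mem_map.1 hb
    simpa using hW t (List.mem_range.1 ht) b hq
  -- some bound on the costs of the queries exists
  have hex : ∃ W, ∀ t < T, ∀ b, M.queryAt ψ a t = some b →
      b.length + (b.length + 2) ^ k + τ b + (ψ b).length + 3 ≤ W := by
    refine ⟨(Finset.range T).sup fun t => match M.queryAt ψ a t with
      | some b => b.length + (b.length + 2) ^ k + τ b + (ψ b).length + 3
      | none => 0, fun t ht b hb => ?_⟩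
    refine le_trans (le_of_eq ?_) (Finset.le_sup (Finset.mem_range.2 ht))
    simp [hb]
  obtain ⟨W, hW⟩ := hex
  obtain ⟨l', T₂, he₂, hc₂, -, hmem₂, hrec₂⟩ := hsim W (hmemW W hW)
  obtain ⟨h1, h2, h3⟩ := hfin l' T₂ he₂ hc₂
  refine ⟨_, h1, ?_, encard_lookaheadRevisions_le h1.1 ?_, ?_, fun W' hW' => ?_⟩
  · rw [h2, ← Tape.word_map (Sum.inl : M.Aux → CompAux M.Aux N.Aux), ← hc₂ .output]
    rfl
  · rw [← h3, records_append]
    have h4 : records (inflate k (0, 0)) l' = _ := hrec₂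
    rw [show inflate k (0, 0) = (0, 0) by simp [inflate]] at h4
    rw [show records (0, 0) [(none : Option (List A))] = (0, 0) from rfl, h4]
    exact records_snd_le hr ψ a T
  · intro t ht b hb s hs b' hb'
    have hx : some b' ∈ [none] ++ l' := List.mem_append_right _ <|
      hmem₂ b (List.mem_map.2 ⟨t, List.mem_range.2 ht, hb⟩) _
        (List.mem_map.2 ⟨s, List.mem_range.2 hs, hb'⟩)
    rw [h3] at hx
    obtain ⟨t', ht', hq⟩ := List.mem_map.1 hx
    exact (maxLength_le_iff.1 le_rfl).2 t' (List.mem_range.1 ht') b' hq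
  · obtain ⟨l'', T₃, he₃, hc₃, hl, -, -⟩ := hsim W' (hmemW W' hW')
    rw [h1.unique (hfin l'' T₃ he₃ hc₃).1]
    simp only [List.length_map, List.length_range, Nat.zero_add] at hl
    simp only [List.length_append, List.length_singleton]
    omega

end Composite

open OracleMachine Polynomial in
/-- The letter `x₀` is the one that the inflated queries consist of. -/
theorem comp_mem_MPT {A : Type u} (x₀ : A) {F G : Operator A} (hF : F ∈ MPT A)
    (hG : G ∈ MPTOne A) : F ∘ G ∈ MPT A := by
  obtain ⟨M, hMF, ⟨p, hp⟩, r, hr⟩ := hF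
  obtain ⟨N, hNG, ⟨q, hq⟩, hN1⟩ := hG
  obtain ⟨k, hk, hqk⟩ := exists_eval_add_two_le q
  have main : ∀ (φ : Baire A) (a : List A), ∃ (T : ℕ) (τ : List A → ℕ) (T' : ℕ),
      M.HaltsIn (G φ) a T ∧ (∀ b, N.HaltsIn φ b (τ b)) ∧
      (∀ b, (G φ b).length ≤ τ b) ∧
      (composite M N k x₀).HaltsIn φ a T' ∧
      (((composite M N k x₀).run φ a T').tape .output).word = F (G φ) a ∧
      ((composite M N k x₀).lookaheadRevisions φ a).encard ≤ r ∧
      (∀ t < T, ∀ b, M.queryAt (G φ) a t = some b → ∀ s < τ b, ∀ b',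
        N.queryAt φ b s = some b' →
        (φ b').length ≤ (composite M N k x₀).maxLength φ a T') ∧
      ∀ W, (∀ t < T, ∀ b, M.queryAt (G φ) a t = some b →
        b.length + (b.length + 2) ^ k + τ b + (G φ b).length + 3 ≤ W) →
        T' ≤ 1 + T * (17 * (T * (W + 1)) + 40) := by
    intro φ a
    choose τ hτ hout using hNG φ
    obtain ⟨T, hT, hTout⟩ := hMF (G φ) a
    obtain ⟨T', h1, h2, h3, h4, h5⟩ := exists_haltsIn_composite (x₀ := x₀) hk hτ hout
      (fun b t ht b' hb' => by
        have := length_query_le_of_lookaheadRevisionLE_one hq (monotone_eval q) hN1 (hτ b).2 ht hb'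
        have := hqk b.length
        omega) hT hr
    exact ⟨T, τ, T', hT, hτ, fun b => hout b ▸ length_output_le (hτ b).2, h1, h2.trans hTout,
      h3, h4, h5⟩
  refine ⟨composite M N k x₀, fun φ a => ?_, ?_, r, fun φ a => ?_⟩
  · obtain ⟨T, τ, T', -, -, -, h1, h2, -⟩ := main φ a
    exact ⟨T', h1, h2⟩
  · let g : Polynomial ℕ := p.comp (X + q) + 1 + X
    -- bounds on the queries of the outer machine, on its number of steps, and on the cost of
    -- answering one of its queries
    let B : Polynomial ℕ := g.comp^[r] X
    let S : Polynomial ℕ := p.comp (B + q.comp B)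
    let W : Polynomial ℕ := B + (B + 2) ^ k + q.comp B + q.comp B + 3
    refine ⟨1 + S * (17 * (S * (W + 1)) + 40), fun φ a => ?_⟩
    obtain ⟨T, τ, T', hT, hτ, hlen, h1, -, -, h4, h5⟩ := main φ a
    refine ⟨T', h1, ?_⟩
    set m := (composite M N k x₀).maxLength φ a T' with hm
    have ha : a.length ≤ m := (maxLength_le_iff.1 le_rfl).1
    have hqm := monotone_eval q
    have hpm := monotone_eval p
    have hτq : ∀ x, m ≤ x → ∀ t < T, ∀ b, M.queryAt (G φ) a t = some b → b.length ≤ x →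
        τ b ≤ q.eval x := by
      intro x hx t ht b hb hbx
      obtain ⟨T'', hT'', hle⟩ := hq φ b
      rw [hT''.unique (hτ b)] at hle
      refine hle.trans (hqm (maxLength_le_iff.2 ⟨hbx, fun s hs b' hb' => ?_⟩))
      exact (h4 t ht b hb s hs b' hb').trans hx
    have hBe : B.eval m = (fun x => g.eval x)^[r] m := by
      simp only [B, iterate_comp_eval, eval_X]
    have hge : ∀ x, g.eval x = p.eval (x + q.eval x) + 1 + x := fun x => by simp [g]
    have hB : ∀ t < T, ∀ b, M.queryAt (G φ) a t = some b → b.length ≤ B.eval m := by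
      intro t ht b hb
      rw [hBe]
      refine hp.length_query_le_iterate hpm ha (f := fun x => x + q.eval x)
        (fun x => Nat.le_add_right _ _) (fun x => ?_) (fun x => ?_) hT.2
        (fun x hx t ht b hb hbx => ?_) hr ht hb
      · simp only [hge]; omega
      · simp only [hge]; omega
      · exact (hlen b).trans ((hτq x hx t ht b hb hbx).trans (Nat.le_add_left _ _))
    have hmB : m ≤ B.eval m := by
      rw [hBe]
      have : ∀ i, m ≤ (fun x => g.eval x)^[i] m := fun i => by
        induction i with
        | zero => exact le_rfl
        | succ i ih =>
          rw [Function.iterate_succ_apply']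
          refine ih.trans ?_
          simp only [hge]
          omega
      exact this r
    have hTS : T ≤ S.eval m := by
      obtain ⟨T'', hT'', hle⟩ := hp (G φ) a
      rw [hT''.unique hT] at hle
      simp only [S, eval_comp, eval_add]
      refine hle.trans (hpm (maxLength_le_iff.2
        ⟨ha.trans (hmB.trans (Nat.le_add_right _ _)), fun t ht b hb => ?_⟩))
      exact (hlen b).trans ((hτq _ hmB t ht b hb (hB t ht b hb)).trans (Nat.le_add_left _ _))
    have hT' := h5 (W.eval m) fun t ht b hb => by
      have e1 := hB t ht b hb
      have e2 := hτq _ hmB t ht b hb e1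
      have e3 := hlen b
      have e4 : (b.length + 2) ^ k ≤ (B.eval m + 2) ^ k := Nat.pow_le_pow_left (by omega) k
      simp only [W, eval_comp, eval_add, eval_pow, eval_ofNat]
      omega
    refine hT'.trans ?_
    simp only [eval_add, eval_mul, eval_one, eval_ofNat]
    gcongr
  · obtain ⟨T, τ, T', -, -, -, -, -, h3, -⟩ := main φ a
    exact h3

end TypeTwo

theorem mainTheorem10 {A : Type*} [Finite A] (F G : TypeTwo.Operator A)
    (hF : F ∈ TypeTwo.MPT A) (hG : G ∈ TypeTwo.MPTOne A) :
    F ∘ G ∈ TypeTwo.MPT A := by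
  rcases isEmpty_or_nonempty A with hA | ⟨⟨x₀⟩⟩
  · rwa [Subsingleton.elim (F ∘ G) F]
  · exact TypeTwo.comp_mem_MPT x₀ hF hG
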